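/- Let $g:\mathbb{R}^n\to\mathbb{R}^n$ be a polynomial vector field and let $\tilde x\in\mathbb{R}^n$ satisfy $g(\tilde x)=0$ (A1). Assume that the eigenvalues of the Jacobian matrix $Dg(\tilde x)$ are real, nonzero and distinct (A2). Let $\lambda_1,\dots,\lambda_m<0$ be all the negative (stable) eigenvalues of $Dg(\tilde x)$, each listed once, and let $\xi_1,\dots,\xi_m\in\mathbb{R}^n$ be associated eigenvectors. Assume that they are non-resonant (A3): $\alpha_1\lambda_1+\dots+\alpha_m\lambda_m\neq\lambda_j$ for all $j\in\{1,\dots,m\}$ and all $\alpha\in\mathbb{N}^m$ with $|\alpha|=\alpha_1+\dots+\alpha_m\ge 2$. Let $\ell^1$ be the space of real families $b=(b_\alpha)_{|\alpha|\ge 2}$, $\alpha\in\mathbb{N}^m$, with $\sum_{|\alpha|\ge2}|b_\alpha|<\infty$. For $a=(a_1,\dots,a_n)\in(\ell^1)^n$ put $a_\alpha=((a_1)_\alpha,\dots,(a_n)_\alpha)\in\mathbb{R}^n$ for $|\alpha|\ge2$, $a_0=\tilde x$ and $a_{e_k}=\xi_k$ for $k=1,\dots,m$. Let $(g(a))_\alpha\in\mathbb{R}^n$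 be the coefficient of $\theta^\alpha$ in the formal power series $g\bigl(\sum_{|\alpha|\ge0}a_\alpha\theta^\alpha\bigr)$ (products being Cauchy products), and let $$(F(a))_\alpha=(\alpha\cdot\lambda)\,a_\alpha-(g(a))_\alpha,\qquad |\alpha|\ge2,\qquad \alpha\cdot\lambda=\alpha_1\lambda_1+\dots+\alpha_m\lambda_m .$$ **Theorem.** Suppose that $\tilde a\in(\ell^1)^n$ satisfies $F(\tilde a)=0$. Then the series $$P(\theta)=\tilde x+\sum_{k=1}^m\xi_k\theta_k+\sum_{|\alpha|\ge2}\tilde a_\alpha\theta^\alpha$$ converges absolutely and uniformly on the closed complex unit polydisc $\{z\in\mathbb{C}^m:|z_k|\le1,\ k=1,\dots,m\}$, and its restriction to the real points $B_1^m=[-1,1]^m$ of the polydisc, with values in $\mathbb{R}^n$, parameterizes a local stable manifold of $\tilde x$. That is: 1. $P$ is continuous and one-to-one on $B_1^m$, and it is real analytic with injective derivative at every point of the open polydisc $(-1,1)^m$; 2. $P(0)=\tilde x$ and $DP(0)=[\xi_1|\cdots|\xi_m]$; 3. for every $\theta\in B_1^m$, the curve $t\mapsto P(e^{\Lambda t}\theta)$,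 $t\ge0$, with $\Lambda=\mathrm{diag}(\lambda_1,\dots,\lambda_m)$, solves $\dot x=g(x)$ with initial value $P(\theta)$; 4. $P(B_1^m)=W^s_{\rm loc}(\tilde x)$, in the sense that there is a neighborhood $U$ of $\tilde x$ in $\mathbb{R}^n$ such that $P(B_1^m)$ is exactly the set of all $y\in\mathbb{R}^n$ for which the solution of $\dot x=g(x)$, $x(0)=y$, exists for all $t\ge0$, stays in $U$ for all $t\ge0$, and converges to $\tilde x$ as $t\to\infty$. -/

import Mathlib

open Filter Topology
open scoped ENNReal

namespace StableParam

/-- Multi-indices `α ∈ ℕ^m` with `|α| = α₁ + ⋯ + α_m ≥ 2`. -/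
abbrev MultiIndex (m : ℕ) : Type := {α : Fin m →₀ ℕ // 2 ≤ α.degree}

/-- The Banach space `ℓ¹` of absolutely summable real families `(b_α)`, `|α| ≥ 2`. -/
abbrev EllOne (m : ℕ) : Type := lp (fun _ : MultiIndex m => ℝ) 1

/-- The vector field on `ℝ^n` whose components are the polynomials `g_1, …, g_n`. -/
noncomputable def vectorField {n : ℕ} (g : Fin n → MvPolynomial (Fin n) ℝ)
    (x : Fin n → ℝ) : Fin n → ℝ :=
  fun j => MvPolynomial.eval x (g j)

/-- The Jacobian matrix `Dg(x)`. -/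
noncomputable def jacobian {n : ℕ} (g : Fin n → MvPolynomial (Fin n) ℝ)
    (x : Fin n → ℝ) : Matrix (Fin n) (Fin n) ℝ :=
  Matrix.of fun i j => MvPolynomial.eval x (MvPolynomial.pderiv j (g i))

/-- All (complex) eigenvalues of the real matrix `J` are real, nonzero and pairwise distinct
(as roots of the characteristic polynomial, counted with multiplicity). -/
def HasRealDistinctNonzeroEigenvalues {n : ℕ} (J : Matrix (Fin n) (Fin n) ℝ) : Prop :=
  J.charpoly.Splits ∧ J.charpoly.roots.Nodup ∧ ∀ μ ∈ J.charpoly.roots, μ ≠ 0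

/-- `lam_1, …, lam_m` is an enumeration without repetition of all negative eigenvalues of `J`. -/
def EnumeratesStableEigenvalues {n m : ℕ} (J : Matrix (Fin n) (Fin n) ℝ)
    (lam : Fin m → ℝ) : Prop :=
  Function.Injective lam ∧
    ∀ μ : ℝ, (∃ k, lam k = μ) ↔ (μ < 0 ∧ Module.End.HasEigenvalue (Matrix.toLin' J) μ)

/-- No resonance `α₁ lam_1 + ⋯ + α_m lam_m = lam_j` of any order `|α| ≥ 2`. -/
def NonResonant {m : ℕ} (lam : Fin m → ℝ) : Prop :=
  ∀ (α : MultiIndex m) (j : Fin m), (∑ k, (α.1 k : ℝ) * lam k) - lam j ≠ 0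

/-- The `j`-th component, as a formal power series in `θ_1, …, θ_m`, of the expansion with
coefficients `x` at order `0`, `ξ_k` at `e_k`, and `a_α` at `|α| ≥ 2`. -/
noncomputable def taylorSeries {n m : ℕ} (x : Fin n → ℝ) (ξ : Fin m → Fin n → ℝ)
    (a : Fin n → EllOne m) (j : Fin n) : MvPowerSeries (Fin m) ℝ :=
  fun α =>
    if h : 2 ≤ α.degree then a j ⟨α, h⟩
    else if α = 0 then x j
    else ∑ k, if α = Finsupp.single k 1 then ξ k j else 0

/-- The map `F`: `(F_j(a))_α = (α · lam) (a_j)_α - (g_j(a))_α` for `|α| ≥ 2`, where `g_j(a)` is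
the polynomial `g_j` evaluated at the formal power series of `a` with the Cauchy product. -/
noncomputable def zeroMap {n m : ℕ} (g : Fin n → MvPolynomial (Fin n) ℝ) (lam : Fin m → ℝ)
    (x : Fin n → ℝ) (ξ : Fin m → Fin n → ℝ) (a : Fin n → EllOne m) :
    Fin n → MultiIndex m → ℝ :=
  fun j α => (∑ k, (α.1 k : ℝ) * lam k) * a j α -
    MvPowerSeries.coeff α.1 (MvPolynomial.aeval (taylorSeries x ξ a) (g j))

/-- The term `(a_j)_α θ^α` of the Taylor expansion, for real or complex `θ`. -/
noncomputable def taylorTerm (𝕜 : Type) [RCLike 𝕜] {n m : ℕ} (a : Fin n → EllOne m)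
    (j : Fin n) (α : MultiIndex m) (θ : Fin m → 𝕜) : 𝕜 :=
  ((a j α : ℝ) : 𝕜) * ∏ k, θ k ^ (α.1 k)

/-- `P(θ) = x + ∑_k ξ_k θ_k + ∑_{|α| ≥ 2} a_α θ^α`, for real or complex `θ`. -/
noncomputable def parameterization (𝕜 : Type) [RCLike 𝕜] {n m : ℕ} (x : Fin n → ℝ)
    (ξ : Fin m → Fin n → ℝ) (a : Fin n → EllOne m) (θ : Fin m → 𝕜) : Fin n → 𝕜 :=
  fun j => (x j : 𝕜) + ∑ k, (ξ k j : 𝕜) * θ k + ∑' α, taylorTerm 𝕜 a j α θ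

/-- The closed unit polydisc in `𝕜^m`. -/
def polydisc (𝕜 : Type) [RCLike 𝕜] (m : ℕ) : Set (Fin m → 𝕜) :=
  {θ | ∀ k, ‖θ k‖ ≤ 1}

/-- The open unit polydisc in `𝕜^m`. -/
def openPolydisc (𝕜 : Type) [RCLike 𝕜] (m : ℕ) : Set (Fin m → 𝕜) :=
  {θ | ∀ k, ‖θ k‖ < 1}

/-- The linear flow `e^{Λt} θ` with `Λ = diag(lam_1, …, lam_m)`. -/
noncomputable def linearFlow {m : ℕ} (lam : Fin m → ℝ) (t : ℝ) (θ : Fin m → ℝ) : Fin m → ℝ :=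
  fun k => Real.exp (lam k * t) * θ k

/-- `u` solves `u' = g(u)` on `[0, ∞)` with `u(0) = y`. -/
def IsForwardSolution {n : ℕ} (g : Fin n → MvPolynomial (Fin n) ℝ) (y : Fin n → ℝ)
    (u : ℝ → Fin n → ℝ) : Prop :=
  u 0 = y ∧ ∀ t, 0 ≤ t → HasDerivWithinAt u (vectorField g (u t)) (Set.Ici 0) t

/-- The local stable manifold of `p` relative to `U`: the points whose forward trajectory exists
for all times, stays in `U`, and converges to `p`. -/
def localStableManifold {n : ℕ} (g : Fin n → MvPolynomial (Fin n) ℝ) (p : Fin n → ℝ)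
    (U : Set (Fin n → ℝ)) : Set (Fin n → ℝ) :=
  {y | ∃ u : ℝ → Fin n → ℝ, IsForwardSolution g y u ∧ (∀ t, 0 ≤ t → u t ∈ U) ∧
    Tendsto u atTop (𝓝 p)}

end StableParam

namespace StableParam

/-! Power series with absolutely summable coefficients form an algebra on which evaluation at a
point of the polydisc is multiplicative. The equation F(ã) = 0 at orders at least two, g(x̃) = 0 at
order zero and the eigenvector equations at order one together say that multiplying the α-th
coefficient of P by α·λ gives the α-th coefficient of g(P) (`weight_mul_coeff`). Along the linear
flow θ^α is multiplied by e^{(α·λ)t}, so termwise differentiation turns this identity into the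
differential equation (`isForwardSolution_parameterization`).

One-to-oneness is transported from the origin. DP(0) has independent columns, so P is bounded below
near 0. The linear flow contracts the whole polydisc into that neighborhood in a fixed time, while
Grönwall's inequality limits how much the distance of the image points grows. This gives a lower
Lipschitz bound on the closed polydisc (`exists_norm_sub_le_parameterization`), hence injectivity of
P and of its derivatives.

Near x̃, the form ∑ sign(μ_i) w_i² in eigencoordinates is nondecreasing along the difference of two
orbits. If both converge to x̃, its initial value is therefore at most 0
(`exists_signForm_sub_nonpos`). An orbit start y is compared with the point P(θ) having the same
stable coordinates: the form is then a sum of squares, so y = P(θ) (`exists_nhds_mem_image`). A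
first-entry-time argument extends this from small neighborhoods to the full image
(`exists_image_eq_localStableManifold`). -/

variable {n m : ℕ}

/-! ### The algebra of absolutely summable power series and evaluation on the polydisc. -/

/-- Formal power series with absolutely summable coefficients. -/
def AbsSummable (f : MvPowerSeries (Fin m) ℝ) : Prop :=
  Summable fun α => ‖MvPowerSeries.coeff α f‖

/-- The monomial `θ^α`. -/
noncomputable def monom (θ : Fin m → ℝ) (α : Fin m →₀ ℕ) : ℝ := ∏ k, θ k ^ α k

/-- The sum of a power series at the point `θ`. -/
noncomputable def seriesEval (θ : Fin m → ℝ) (f : MvPowerSeries (Fin m) ℝ) : ℝ :=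
  ∑' α, MvPowerSeries.coeff α f * monom θ α

lemma monom_zero_index (θ : Fin m → ℝ) : monom θ 0 = 1 := by simp [monom]

lemma monom_add (θ : Fin m → ℝ) (α β : Fin m →₀ ℕ) :
    monom θ (α + β) = monom θ α * monom θ β := by
  simp [monom, pow_add, Finset.prod_mul_distrib]

lemma monom_single (θ : Fin m → ℝ) (k : Fin m) : monom θ (Finsupp.single k 1) = θ k := by
  rw [monom, Finset.prod_eq_single k] <;> simp +contextual [eq_comm]

lemma norm_monom_le {θ : Fin m → ℝ} (hθ : θ ∈ polydisc ℝ m) (α : Fin m →₀ ℕ) :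
    ‖monom θ α‖ ≤ 1 := by
  rw [monom, norm_prod]
  exact Finset.prod_le_one (fun _ _ => norm_nonneg _)
    fun k _ => by rw [norm_pow]; exact pow_le_one₀ (norm_nonneg _) (hθ k)

lemma AbsSummable.summable_mul_monom {f : MvPowerSeries (Fin m) ℝ} (hf : AbsSummable f)
    {θ : Fin m → ℝ} (hθ : θ ∈ polydisc ℝ m) :
    Summable fun α => ‖MvPowerSeries.coeff α f * monom θ α‖ :=
  Summable.of_nonneg_of_le (fun _ => norm_nonneg _) (fun α => by
    rw [norm_mul]; exact mul_le_of_le_one_right (norm_nonneg _) (norm_monom_le hθ α)) hf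

lemma AbsSummable.add {f g : MvPowerSeries (Fin m) ℝ} (hf : AbsSummable f)
    (hg : AbsSummable g) : AbsSummable (f + g) :=
  Summable.of_nonneg_of_le (fun _ => norm_nonneg _)
    (fun α => by rw [map_add]; exact norm_add_le _ _) (Summable.add hf hg)

lemma summable_sum_antidiagonal {F G : (Fin m →₀ ℕ) → ℝ} (hF : Summable fun α => ‖F α‖)
    (hG : Summable fun α => ‖G α‖) :
    Summable fun α => ∑ p ∈ Finset.HasAntidiagonal.antidiagonal α, F p.1 * G p.2 := by
  have h : Summable fun p : (Fin m →₀ ℕ) × (Fin m →₀ ℕ) => F p.1 * G p.2 :=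
    summable_mul_of_summable_norm hF hG
  exact summable_sum_mul_antidiagonal_of_summable_mul h

lemma tsum_mul_tsum_antidiagonal {F G : (Fin m →₀ ℕ) → ℝ} (hF : Summable fun α => ‖F α‖)
    (hG : Summable fun α => ‖G α‖) :
    (∑' α, F α) * ∑' α, G α = ∑' α, ∑ p ∈ Finset.HasAntidiagonal.antidiagonal α, F p.1 * G p.2 := by
  have h : Summable fun p : (Fin m →₀ ℕ) × (Fin m →₀ ℕ) => F p.1 * G p.2 :=
    summable_mul_of_summable_norm hF hG
  exact hF.of_norm.tsum_mul_tsum_eq_tsum_sum_antidiagonal hG.of_norm h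

/-- The coefficients of a product are dominated by the Cauchy product of the absolute values, which
is summable. -/
lemma AbsSummable.mul {f g : MvPowerSeries (Fin m) ℝ} (hf : AbsSummable f)
    (hg : AbsSummable g) : AbsSummable (f * g) := by
  have h := summable_sum_antidiagonal (F := fun α => ‖MvPowerSeries.coeff α f‖)
    (G := fun α => ‖MvPowerSeries.coeff α g‖) (Summable.norm hf) (Summable.norm hg)
  refine Summable.of_nonneg_of_le (fun _ => norm_nonneg _) (fun α => ?_) h
  rw [MvPowerSeries.coeff_mul]
  exact (norm_sum_le _ _).trans_eq (Finset.sum_congr rfl fun _ _ => norm_mul _ _)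

lemma absSummable_monomial (α : Fin m →₀ ℕ) (c : ℝ) :
    AbsSummable (MvPowerSeries.monomial α c) := by
  classical
  refine summable_of_ne_finset_zero (s := {α}) fun β hβ => ?_
  rw [MvPowerSeries.coeff_monomial, if_neg (by simpa using hβ), norm_zero]

lemma seriesEval_monomial (θ : Fin m → ℝ) (α : Fin m →₀ ℕ) (c : ℝ) :
    seriesEval θ (MvPowerSeries.monomial α c) = c * monom θ α := by
  classical
  rw [seriesEval, tsum_eq_single α]
  · simp
  · intro β hβ
    rw [MvPowerSeries.coeff_monomial, if_neg hβ, zero_mul]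

lemma seriesEval_add {f g : MvPowerSeries (Fin m) ℝ} (hf : AbsSummable f)
    (hg : AbsSummable g) {θ : Fin m → ℝ} (hθ : θ ∈ polydisc ℝ m) :
    seriesEval θ (f + g) = seriesEval θ f + seriesEval θ g := by
  simp only [seriesEval, map_add, add_mul]
  exact (hf.summable_mul_monom hθ).of_norm.tsum_add (hg.summable_mul_monom hθ).of_norm

/-- `monom θ` is multiplicative, hence factors out of each antidiagonal; what remains is the Cauchy
product theorem. -/
lemma seriesEval_mul {f g : MvPowerSeries (Fin m) ℝ} (hf : AbsSummable f)
    (hg : AbsSummable g) {θ : Fin m → ℝ} (hθ : θ ∈ polydisc ℝ m) :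
    seriesEval θ (f * g) = seriesEval θ f * seriesEval θ g := by
  have hF := hf.summable_mul_monom hθ
  have hG := hg.summable_mul_monom hθ
  rw [seriesEval, seriesEval, seriesEval, tsum_mul_tsum_antidiagonal hF hG]
  refine tsum_congr fun α => ?_
  rw [MvPowerSeries.coeff_mul, Finset.sum_mul]
  refine Finset.sum_congr rfl fun p hp => ?_
  rw [← Finset.HasAntidiagonal.mem_antidiagonal.1 hp, monom_add]
  ring

lemma algebraMap_eq_monomial (c : ℝ) :
    algebraMap ℝ (MvPowerSeries (Fin m) ℝ) c = MvPowerSeries.monomial 0 c := by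
  rw [MvPowerSeries.monomial_zero_eq_C_apply, MvPowerSeries.algebraMap_apply]; rfl

/-- Polynomials in absolutely summable power series are absolutely summable, and evaluation
at a point of the polydisc commutes with them. -/
lemma absSummable_aeval {φ : Fin n → MvPowerSeries (Fin m) ℝ} (hφ : ∀ j, AbsSummable (φ j))
    (p : MvPolynomial (Fin n) ℝ) :
    AbsSummable (MvPolynomial.aeval φ p) ∧ ∀ θ ∈ polydisc ℝ m,
      seriesEval θ (MvPolynomial.aeval φ p) =
        MvPolynomial.eval (fun j => seriesEval θ (φ j)) p := by
  induction p using MvPolynomial.induction_on with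
  | C c =>
    rw [MvPolynomial.aeval_C, algebraMap_eq_monomial]
    exact ⟨absSummable_monomial _ _, fun θ _ => by
      rw [seriesEval_monomial, monom_zero_index, MvPolynomial.eval_C, mul_one]⟩
  | add p q hp hq =>
    rw [map_add]
    exact ⟨hp.1.add hq.1, fun θ hθ => by
      rw [seriesEval_add hp.1 hq.1 hθ, map_add, hp.2 θ hθ, hq.2 θ hθ]⟩
  | mul_X p i hp =>
    rw [map_mul, MvPolynomial.aeval_X]
    exact ⟨hp.1.mul (hφ i), fun θ hθ => by
      rw [seriesEval_mul hp.1 (hφ i) hθ, map_mul, hp.2 θ hθ, MvPolynomial.eval_X]⟩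

/-- With `coeff_single_aeval`, this gives g(a) at orders 0 and 1, where the equation F(a) = 0 says
nothing. -/
lemma coeff_zero_aeval (φ : Fin n → MvPowerSeries (Fin m) ℝ) (p : MvPolynomial (Fin n) ℝ) :
    MvPowerSeries.coeff 0 (MvPolynomial.aeval φ p) =
      MvPolynomial.eval (fun j => MvPowerSeries.coeff 0 (φ j)) p := by
  induction p using MvPolynomial.induction_on with
  | C c => rw [MvPolynomial.aeval_C, algebraMap_eq_monomial]; simp
  | add p q hp hq => rw [map_add, map_add, map_add, hp, hq]
  | mul_X p i hp => 
    rw [map_mul, MvPolynomial.aeval_X, map_mul (MvPolynomial.eval _), MvPolynomial.eval_X,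
      ← hp, MvPowerSeries.coeff_mul, Finsupp.antidiagonal_zero, Finset.sum_singleton]

lemma coeff_single_mul (k : Fin m) (f g : MvPowerSeries (Fin m) ℝ) :
    MvPowerSeries.coeff (Finsupp.single k 1) (f * g) =
      MvPowerSeries.coeff 0 f * MvPowerSeries.coeff (Finsupp.single k 1) g +
        MvPowerSeries.coeff (Finsupp.single k 1) f * MvPowerSeries.coeff 0 g := by
  rw [MvPowerSeries.coeff_mul, Finsupp.antidiagonal_single]
  simp [Finset.Nat.antidiagonal_succ]

/-- The linear coefficients of a polynomial in power series (chain rule at the origin). -/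
lemma coeff_single_aeval (φ : Fin n → MvPowerSeries (Fin m) ℝ) (p : MvPolynomial (Fin n) ℝ)
    (k : Fin m) :
    MvPowerSeries.coeff (Finsupp.single k 1) (MvPolynomial.aeval φ p) =
      ∑ j, MvPolynomial.eval (fun j => MvPowerSeries.coeff 0 (φ j)) (MvPolynomial.pderiv j p) *
        MvPowerSeries.coeff (Finsupp.single k 1) (φ j) := by
  induction p using MvPolynomial.induction_on with
  | C c =>
    rw [MvPolynomial.aeval_C, algebraMap_eq_monomial, MvPowerSeries.coeff_monomial]
    simp
  | add p q hp hq =>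
    simp only [map_add, hp, hq, add_mul, Finset.sum_add_distrib]
  | mul_X p i hp =>
    rw [map_mul, MvPolynomial.aeval_X, coeff_single_mul, hp, coeff_zero_aeval]
    simp only [MvPolynomial.pderiv_mul, MvPolynomial.pderiv_X, map_add, map_mul, add_mul,
      Finset.sum_add_distrib, MvPolynomial.eval_X]
    rw [add_comm]
    congr 1
    · rw [Finset.sum_mul]
      exact Finset.sum_congr rfl fun j _ => by ring
    · rw [Finset.sum_eq_single i]
      · simp
      · intro j _ hj
        simp [hj.symm]
      · simp

/-! ### Convergence of the Taylor expansion and its formal counterpart. -/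

lemma summable_norm_ellOne (b : EllOne m) : Summable fun α => ‖b α‖ := by
  have h := lp.memℓp b
  rw [memℓp_gen_iff (by norm_num)] at h
  simpa using h

lemma norm_taylorTerm_le {𝕜 : Type} [RCLike 𝕜] (a : Fin n → EllOne m) (j : Fin n)
    (α : MultiIndex m) {θ : Fin m → 𝕜} (hθ : θ ∈ polydisc 𝕜 m) :
    ‖taylorTerm 𝕜 a j α θ‖ ≤ ‖a j α‖ := by
  rw [taylorTerm, norm_mul, norm_prod, RCLike.norm_ofReal, Real.norm_eq_abs]
  refine mul_le_of_le_one_right (abs_nonneg _) (Finset.prod_le_one (fun _ _ => norm_nonneg _)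
    fun k _ => ?_)
  rw [norm_pow]
  exact pow_le_one₀ (norm_nonneg _) (hθ k)

lemma summable_norm_taylorTerm {𝕜 : Type} [RCLike 𝕜] (a : Fin n → EllOne m) (j : Fin n)
    {θ : Fin m → 𝕜} (hθ : θ ∈ polydisc 𝕜 m) :
    Summable fun α => ‖taylorTerm 𝕜 a j α θ‖ :=
  Summable.of_nonneg_of_le (fun _ => norm_nonneg _) (fun α => norm_taylorTerm_le a j α hθ)
    (summable_norm_ellOne (a j))

lemma tendstoUniformlyOn_taylorTerm (𝕜 : Type) [RCLike 𝕜] (a : Fin n → EllOne m) (j : Fin n) :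
    TendstoUniformlyOn (fun (s : Finset (MultiIndex m)) z => ∑ α ∈ s, taylorTerm 𝕜 a j α z)
      (fun z => ∑' α, taylorTerm 𝕜 a j α z) atTop (polydisc 𝕜 m) :=
  tendstoUniformlyOn_tsum (summable_norm_ellOne (a j)) fun α _ hz => norm_taylorTerm_le a j α hz

lemma continuousOn_parameterization (x : Fin n → ℝ) (ξ : Fin m → Fin n → ℝ)
    (a : Fin n → EllOne m) : ContinuousOn (parameterization ℝ x ξ a) (polydisc ℝ m) := by
  refine continuousOn_pi.2 fun j => ContinuousOn.add (by fun_prop) ?_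
  refine (tendstoUniformlyOn_taylorTerm ℝ a j).continuousOn (Eventually.frequently
    (Eventually.of_forall fun s => ?_))
  unfold taylorTerm
  fun_prop

/-- The part of order at least two of the expansion. -/
noncomputable def tailSeries (b : EllOne m) : MvPowerSeries (Fin m) ℝ :=
  fun α => if h : 2 ≤ α.degree then b ⟨α, h⟩ else 0

lemma coeff_tailSeries_of_le (b : EllOne m) (α : MultiIndex m) :
    MvPowerSeries.coeff α.1 (tailSeries b) = b α :=
  dif_pos α.2

lemma coeff_tailSeries_of_notMem (b : EllOne m) {α : Fin m →₀ ℕ}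
    (h : α ∉ Set.range (Subtype.val : MultiIndex m → Fin m →₀ ℕ)) :
    MvPowerSeries.coeff α (tailSeries b) = 0 :=
  dif_neg fun h' => h ⟨⟨α, h'⟩, rfl⟩

lemma absSummable_tailSeries (b : EllOne m) : AbsSummable (tailSeries b) := by
  refine (Subtype.val_injective.summable_iff (g := (Subtype.val : MultiIndex m → _))
    fun α hα => ?_).1 ?_
  · rw [coeff_tailSeries_of_notMem b hα, norm_zero]
  · simpa [Function.comp_def, coeff_tailSeries_of_le] using summable_norm_ellOne b

lemma seriesEval_tailSeries (a : Fin n → EllOne m) (j : Fin n) (θ : Fin m → ℝ) :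
    seriesEval θ (tailSeries (a j)) = ∑' α, taylorTerm ℝ a j α θ := by
  rw [seriesEval, ← Subtype.val_injective.tsum_eq (g := (Subtype.val : MultiIndex m → _))]
  · refine tsum_congr fun α => ?_
    rw [coeff_tailSeries_of_le]
    rfl
  · intro α hα
    by_contra h
    exact hα (by simp only [coeff_tailSeries_of_notMem _ h, zero_mul])

lemma taylorSeries_eq (x : Fin n → ℝ) (ξ : Fin m → Fin n → ℝ) (a : Fin n → EllOne m)
    (j : Fin n) : taylorSeries x ξ a j = MvPowerSeries.monomial 0 (x j) +
      ∑ k, MvPowerSeries.monomial (Finsupp.single k 1) (ξ k j) + tailSeries (a j) := by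
  classical
  ext α
  simp only [map_add, map_sum, MvPowerSeries.coeff_monomial]
  change (if h : 2 ≤ α.degree then _ else _ : ℝ) = _ + if h : 2 ≤ α.degree then _ else _
  by_cases h : 2 ≤ α.degree
  · have h0 : α ≠ 0 := by rintro rfl; simp at h
    have h1 : ∀ k, α ≠ Finsupp.single k 1 := by rintro k rfl; simp at h
    simp [h, h0, h1]
  · by_cases h0 : α = 0
    · subst h0
      simp [eq_comm]
    · simp [h, h0]

lemma coeff_zero_taylorSeries (x : Fin n → ℝ) (ξ : Fin m → Fin n → ℝ) (a : Fin n → EllOne m)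
    (j : Fin n) : MvPowerSeries.coeff 0 (taylorSeries x ξ a j) = x j := by
  change taylorSeries x ξ a j 0 = x j
  simp [taylorSeries]

lemma coeff_single_taylorSeries (x : Fin n → ℝ) (ξ : Fin m → Fin n → ℝ)
    (a : Fin n → EllOne m) (j : Fin n) (k : Fin m) :
    MvPowerSeries.coeff (Finsupp.single k 1) (taylorSeries x ξ a j) = ξ k j := by
  change taylorSeries x ξ a j (Finsupp.single k 1) = ξ k j
  simp [taylorSeries, Finsupp.single_left_inj]

lemma coeff_taylorSeries (x : Fin n → ℝ) (ξ : Fin m → Fin n → ℝ)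
    (a : Fin n → EllOne m) (j : Fin n) (α : MultiIndex m) :
    MvPowerSeries.coeff α.1 (taylorSeries x ξ a j) = a j α :=
  dif_pos α.2

lemma absSummable_sum {ι : Type*} (s : Finset ι) (f : ι → MvPowerSeries (Fin m) ℝ)
    (hf : ∀ i, AbsSummable (f i)) : AbsSummable (∑ i ∈ s, f i) ∧
      ∀ θ ∈ polydisc ℝ m, seriesEval θ (∑ i ∈ s, f i) = ∑ i ∈ s, seriesEval θ (f i) := by
  classical
  induction s using Finset.induction_on with
  | empty => simp [AbsSummable, seriesEval, summable_zero]
  | insert i s hi ih =>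
    simp only [Finset.sum_insert hi]
    exact ⟨(hf i).add ih.1, fun θ hθ => by rw [seriesEval_add (hf i) ih.1 hθ, ih.2 θ hθ]⟩

lemma absSummable_taylorSeries (x : Fin n → ℝ) (ξ : Fin m → Fin n → ℝ)
    (a : Fin n → EllOne m) (j : Fin n) : AbsSummable (taylorSeries x ξ a j) := by
  rw [taylorSeries_eq]
  exact ((absSummable_monomial _ _).add
    (absSummable_sum _ _ fun k => absSummable_monomial _ _).1).add (absSummable_tailSeries _)

lemma seriesEval_taylorSeries (x : Fin n → ℝ) (ξ : Fin m → Fin n → ℝ)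
    (a : Fin n → EllOne m) {θ : Fin m → ℝ} (hθ : θ ∈ polydisc ℝ m) (j : Fin n) :
    seriesEval θ (taylorSeries x ξ a j) = parameterization ℝ x ξ a θ j := by
  have hs := absSummable_sum Finset.univ
    (fun k => MvPowerSeries.monomial (Finsupp.single k 1) (ξ k j))
    fun k => absSummable_monomial _ _
  rw [taylorSeries_eq, seriesEval_add ((absSummable_monomial _ _).add hs.1)
    (absSummable_tailSeries _) hθ, seriesEval_add (absSummable_monomial _ _) hs.1 hθ, hs.2 θ hθ,
    seriesEval_tailSeries, seriesEval_monomial, monom_zero_index, mul_one]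
  simp [parameterization, seriesEval_monomial, monom_single]

/-! ### The invariance equation and the conjugacy with the linear flow. -/

/-- The weight `α · λ`. -/
def weight (lam : Fin m → ℝ) (α : Fin m →₀ ℕ) : ℝ := ∑ k, (α k : ℝ) * lam k

/-- The invariance equation holds coefficientwise, at every order. -/
lemma weight_mul_coeff {g : Fin n → MvPolynomial (Fin n) ℝ} {xt : Fin n → ℝ}
    (hA1 : vectorField g xt = 0) {lam : Fin m → ℝ} {ξ : Fin m → Fin n → ℝ}
    (hξ : ∀ k, Matrix.toLin' (jacobian g xt) (ξ k) = lam k • ξ k)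
    {a : Fin n → EllOne m} (ha : zeroMap g lam xt ξ a = 0) (j : Fin n) (α : Fin m →₀ ℕ) :
    weight lam α * MvPowerSeries.coeff α (taylorSeries xt ξ a j) =
      MvPowerSeries.coeff α (MvPolynomial.aeval (taylorSeries xt ξ a) (g j)) := by
  -- Orders at least two come from F(a) = 0, order zero from g(x̃) = 0, order one from the
  -- eigenvector equation.
  by_cases h : 2 ≤ α.degree
  · rw [coeff_taylorSeries xt ξ a j ⟨α, h⟩]
    exact sub_eq_zero.1 (congrFun (congrFun ha j) ⟨α, h⟩)
  · by_cases h0 : α = 0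
    · subst h0
      rw [coeff_zero_aeval]
      simp only [coeff_zero_taylorSeries]
      rw [show MvPolynomial.eval (fun j => xt j) (g j) = 0 from congrFun hA1 j]
      simp [weight]
    · have h1 : α.degree = 1 := by
        have : α.degree ≠ 0 := fun h' => h0 ((Finsupp.degree_eq_zero_iff α).1 h')
        omega
      obtain ⟨k, rfl⟩ : ∃ k, α = Finsupp.single k 1 := by
        obtain ⟨k, hk⟩ := Finsupp.range_single_one.ge h1
        exact ⟨k, hk.symm⟩
      rw [coeff_single_aeval]
      simp only [coeff_zero_taylorSeries, coeff_single_taylorSeries]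
      have := congrFun (hξ k) j
      simp only [Matrix.toLin'_apply, Matrix.mulVec, dotProduct, jacobian, Matrix.of_apply,
        Pi.smul_apply, smul_eq_mul] at this
      rw [this, weight, Finset.sum_eq_single k] <;> simp +contextual [eq_comm]

lemma linearFlow_zero (lam : Fin m → ℝ) (θ : Fin m → ℝ) : linearFlow lam 0 θ = θ := by
  ext; simp [linearFlow]

lemma linearFlow_add (lam : Fin m → ℝ) (s t : ℝ) (θ : Fin m → ℝ) :
    linearFlow lam s (linearFlow lam t θ) = linearFlow lam (s + t) θ := by
  ext; simp [linearFlow, mul_add, Real.exp_add, mul_assoc]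

lemma linearFlow_mem {lam : Fin m → ℝ} (hl : ∀ k, lam k < 0) {t : ℝ} (ht : 0 ≤ t)
    {θ : Fin m → ℝ} (hθ : θ ∈ polydisc ℝ m) : linearFlow lam t θ ∈ polydisc ℝ m := by
  intro k
  rw [linearFlow, norm_mul, Real.norm_of_nonneg (Real.exp_pos _).le]
  exact mul_le_one₀ (Real.exp_le_one_iff.2 (mul_nonpos_of_nonpos_of_nonneg (hl k).le ht))
    (norm_nonneg _) (hθ k)

lemma monom_linearFlow (lam : Fin m → ℝ) (t : ℝ) (θ : Fin m → ℝ) (α : Fin m →₀ ℕ) :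
    monom (linearFlow lam t θ) α = Real.exp (weight lam α * t) * monom θ α := by
  simp only [monom, linearFlow, weight, mul_pow, Finset.prod_mul_distrib, Finset.sum_mul,
    Real.exp_sum, ← Real.exp_nat_mul, mul_assoc]

/-- For positive times the flow keeps θ in the polydisc, so the differentiated terms are dominated
by the coefficients of `h`. For negative times the point may leave it, hence the restriction to t >
0. -/
lemma hasDerivAt_seriesEval_linearFlow {lam : Fin m → ℝ} (hl : ∀ k, lam k < 0)
    {f h : MvPowerSeries (Fin m) ℝ} (hf : AbsSummable f) (hh : AbsSummable h)
    (hfh : ∀ α, weight lam α * MvPowerSeries.coeff α f = MvPowerSeries.coeff α h)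
    {θ : Fin m → ℝ} (hθ : θ ∈ polydisc ℝ m) {t : ℝ} (ht : 0 < t) :
    HasDerivAt (fun t => seriesEval (linearFlow lam t θ) f)
      (seriesEval (linearFlow lam t θ) h) t := by
  refine hasDerivAt_tsum_of_isPreconnected (𝕜 := ℝ) (F := ℝ)
    (g := fun α t => MvPowerSeries.coeff α f * monom (linearFlow lam t θ) α)
    (g' := fun α t => MvPowerSeries.coeff α h * monom (linearFlow lam t θ) α) (t := Set.Ioi 0) (y₀ := t)
    (u := fun α => ‖MvPowerSeries.coeff α h‖) hh isOpen_Ioi isPreconnected_Ioi ?_ ?_ ht ?_ ht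
  · intro α s _
    simp only [monom_linearFlow]
    have h1 : HasDerivAt (fun s => Real.exp (weight lam α * s))
        (Real.exp (weight lam α * s) * weight lam α) s := by
      simpa using ((hasDerivAt_id s).const_mul (weight lam α)).exp
    refine ((h1.mul_const (monom θ α)).const_mul (MvPowerSeries.coeff α f)).congr_deriv ?_
    rw [← hfh]
    ring
  · intro α s hs
    rw [norm_mul]
    exact mul_le_of_le_one_right (norm_nonneg _) (norm_monom_le (linearFlow_mem hl (le_of_lt hs) hθ) α)
  · exact (hf.summable_mul_monom (linearFlow_mem hl ht.le hθ)).of_norm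

lemma continuous_vectorField (g : Fin n → MvPolynomial (Fin n) ℝ) :
    Continuous (vectorField g) :=
  continuous_pi fun j => MvPolynomial.continuous_eval (g j)

/-- The parameterization conjugates the linear flow to the flow of `g`. -/
lemma isForwardSolution_parameterization {g : Fin n → MvPolynomial (Fin n) ℝ} {xt : Fin n → ℝ}
    (hA1 : vectorField g xt = 0) {lam : Fin m → ℝ} (hl : ∀ k, lam k < 0)
    {ξ : Fin m → Fin n → ℝ}
    (hξ : ∀ k, Matrix.toLin' (jacobian g xt) (ξ k) = lam k • ξ k)
    {a : Fin n → EllOne m} (ha : zeroMap g lam xt ξ a = 0) {θ : Fin m → ℝ}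
    (hθ : θ ∈ polydisc ℝ m) :
    IsForwardSolution g (parameterization ℝ xt ξ a θ)
      (fun t => parameterization ℝ xt ξ a (linearFlow lam t θ)) := by
  set u := fun t => parameterization ℝ xt ξ a (linearFlow lam t θ) with hu
  have hd : ∀ t, 0 < t → HasDerivAt u (vectorField g (u t)) t := by
    intro t ht
    refine hasDerivAt_pi.2 fun j => ?_
    have hag := absSummable_aeval (absSummable_taylorSeries xt ξ a) (g j)
    have hmem := linearFlow_mem hl ht.le hθ
    have key := hasDerivAt_seriesEval_linearFlow hl (absSummable_taylorSeries xt ξ a j) hag.1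
      (weight_mul_coeff hA1 hξ ha j) hθ ht
    rw [hag.2 _ hmem] at key
    simp only [seriesEval_taylorSeries xt ξ a hmem] at key
    refine key.congr_of_eventuallyEq ?_
    filter_upwards [lt_mem_nhds ht] with s hs
    exact (seriesEval_taylorSeries xt ξ a (linearFlow_mem hl (le_of_lt hs) hθ) j).symm
  have hc : ContinuousOn u (Set.Ici 0) :=
    (continuousOn_parameterization xt ξ a).comp
      (continuous_pi fun k => by unfold linearFlow; fun_prop).continuousOn
      fun t ht => linearFlow_mem hl ht hθ
  refine ⟨by simp [hu, linearFlow_zero], fun t ht => ?_⟩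
  rcases ht.eq_or_lt with rfl | ht
  -- At t = 0 only the one-sided derivative is meaningful when θ lies on the boundary; it is the
  -- limit of the derivatives from the right.
  · refine hasDerivWithinAt_Ici_of_tendsto_deriv (s := Set.Ioi 0)
      (fun s hs => (hd s hs).differentiableAt.differentiableWithinAt)
      ((hc 0 Set.self_mem_Ici).mono Set.Ioi_subset_Ici_self) self_mem_nhdsWithin ?_
    have h1 : Tendsto (fun s => vectorField g (u s)) (𝓝[>] 0) (𝓝 (vectorField g (u 0))) :=
      ((continuous_vectorField g).tendsto _).comp
        ((hc 0 Set.self_mem_Ici).mono Set.Ioi_subset_Ici_self)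
    refine h1.congr' ?_
    filter_upwards [self_mem_nhdsWithin] with s hs
    exact (hd s hs).deriv.symm
  · exact (hd t ht).hasDerivWithinAt

/-! ### Real analyticity and the derivative at the origin. -/

/-- Write α as a word of k coordinates and multiply the corresponding projections, each of norm at
most 1 for the sup norm. No symmetrization is needed, since only diagonal values matter. -/
lemma exists_multilinear_monomial {α : Fin m →₀ ℕ} {k : ℕ} (hα : α.degree = k) :
    ∃ φ : ContinuousMultilinearMap ℝ (fun _ : Fin k => Fin m → ℝ) ℝ,
      ‖φ‖ ≤ 1 ∧ ∀ θ, φ (fun _ => θ) = ∏ k, θ k ^ α k := by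
  subst hα
  set l := (Finsupp.toMultiset α).toList with hl
  have hlen : l.length = α.degree := by
    rw [hl, Multiset.length_toList, Finsupp.card_toMultiset]; rfl
  refine ⟨(ContinuousMultilinearMap.mkPiAlgebra ℝ (Fin α.degree) ℝ).compContinuousLinearMap
    fun i => ContinuousLinearMap.proj (R := ℝ) (φ := fun _ : Fin m => ℝ)
      (l.get (i.cast hlen.symm)), ?_, fun θ => ?_⟩
  · refine (ContinuousMultilinearMap.norm_compContinuousLinearMap_le _ _).trans ?_
    rw [ContinuousMultilinearMap.norm_mkPiAlgebra, one_mul]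
    refine Finset.prod_le_one (fun _ _ => norm_nonneg _) fun i _ => ?_
    exact ContinuousLinearMap.opNorm_le_bound _ zero_le_one fun θ => by
      rw [one_mul]; exact norm_le_pi_norm θ _
  · simp only [ContinuousMultilinearMap.compContinuousLinearMap_apply,
      ContinuousMultilinearMap.mkPiAlgebra_apply, ContinuousLinearMap.proj_apply]
    rw [show ∏ i, θ (l.get (Fin.cast hlen.symm i)) = ∏ i, θ (l.get i) from
      (finCongr hlen.symm).prod_comp (fun i => θ (l.get i))]
    have h1 : ∏ i, θ (l.get i) = (l.map θ).prod := by
      simp [← Fin.prod_univ_getElem]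
    rw [h1, ← Multiset.prod_coe, ← Multiset.map_coe, hl, Multiset.coe_toList,
      Finset.prod_multiset_map_count]
    simp only [Finsupp.count_toMultiset]
    refine Finset.prod_subset (Finset.subset_univ _) fun i _ hi => ?_
    simp only [Multiset.mem_toFinset, Finsupp.mem_toMultiset, Finsupp.notMem_support_iff] at hi
    rw [hi, pow_zero]

instance (k : ℕ) : Finite {α : MultiIndex m // α.1.degree = k} :=
  have : Finite {α : Fin m →₀ ℕ // α.degree = k} := Finsupp.finite_of_degree_eq k
  Finite.of_injective (fun α => (⟨α.1.1, α.2⟩ : {α : Fin m →₀ ℕ // α.degree = k}))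
    fun _ _ h => Subtype.ext (Subtype.ext (Subtype.mk.inj h))

noncomputable instance (k : ℕ) : Fintype {α : MultiIndex m // α.1.degree = k} :=
  Fintype.ofFinite _

/-- The homogeneous components of `∑ b_α θ^α`, as a formal multilinear series. -/
noncomputable def tailMultilinear (b : EllOne m) :
    FormalMultilinearSeries ℝ (Fin m → ℝ) ℝ :=
  fun k => ∑ α : {α : MultiIndex m // α.1.degree = k},
    b α.1 • (exists_multilinear_monomial α.2).choose

lemma tailMultilinear_one (b : EllOne m) : tailMultilinear b 1 = 0 :=
  Finset.sum_eq_zero fun α _ => by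
    have h1 := α.1.2
    have h2 := α.2
    omega

/-- The bound does not depend on k, so the radius of convergence is at least 1. -/
lemma norm_tailMultilinear_le (b : EllOne m) (k : ℕ) :
    ‖tailMultilinear b k‖ ≤ ∑' α, ‖b α‖ := by
  have h1 : ‖tailMultilinear b k‖ ≤ ∑ α : {α : MultiIndex m // α.1.degree = k}, ‖b α.1‖ := by
    refine (norm_sum_le _ _).trans (Finset.sum_le_sum fun α _ => ?_)
    rw [norm_smul]
    exact mul_le_of_le_one_right (norm_nonneg _) (exists_multilinear_monomial α.2).choose_spec.1
  refine h1.trans ?_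
  rw [← tsum_fintype (L := .unconditional _)]
  exact (summable_norm_ellOne b).tsum_subtype_le (fun α => ‖b α‖) {α | α.1.degree = k}
    fun _ => norm_nonneg _

lemma hasFPowerSeriesOnBall_tail (a : Fin n → EllOne m) (j : Fin n) :
    HasFPowerSeriesOnBall (fun θ : Fin m → ℝ => ∑' α, taylorTerm ℝ a j α θ)
      (tailMultilinear (a j)) 0 1 where
  r_le := by
    refine (tailMultilinear (a j)).le_radius_of_bound (r := 1) (∑' α, ‖a j α‖) fun k => ?_
    simpa using norm_tailMultilinear_le (a j) k
  r_pos := one_pos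
  hasSum := by
    intro θ hθ
    have hθ' : θ ∈ polydisc ℝ m := fun k => by
      have : ‖θ‖ < 1 := by simpa [← ofReal_norm] using hθ
      exact (norm_le_pi_norm θ k).trans this.le
    have h1 := (summable_norm_taylorTerm a j hθ').of_norm.hasSum
    -- The sum over multi-indices is regrouped by total degree.
    rw [← (Equiv.sigmaFiberEquiv fun α : MultiIndex m => α.1.degree).hasSum_iff] at h1
    rw [zero_add]
    refine h1.sigma fun k => ?_
    have h2 : tailMultilinear (a j) k (fun _ => θ) =
        ∑ α : {α : MultiIndex m // α.1.degree = k}, taylorTerm ℝ a j α.1 θ := by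
      simp only [tailMultilinear, sum_apply, smul_apply, smul_eq_mul]
      refine Finset.sum_congr rfl fun α _ => ?_
      rw [(exists_multilinear_monomial α.2).choose_spec.2]
      rfl
    rw [h2]
    exact hasSum_fintype _

lemma openPolydisc_subset_eball : openPolydisc ℝ m ⊆ Metric.eball 0 1 := by
  intro θ hθ
  have : ‖θ‖ < 1 := (pi_norm_lt_iff one_pos).2 hθ
  simpa [← ofReal_norm] using this

lemma analyticOnNhd_parameterization (x : Fin n → ℝ) (ξ : Fin m → Fin n → ℝ)
    (a : Fin n → EllOne m) :
    AnalyticOnNhd ℝ (parameterization ℝ x ξ a) (openPolydisc ℝ m) := by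
  refine AnalyticOnNhd.pi fun j => AnalyticOnNhd.add (AnalyticOnNhd.add analyticOnNhd_const
    (Finset.analyticOnNhd_fun_sum _ fun k _ => analyticOnNhd_const.mul
      ((ContinuousLinearMap.proj (R := ℝ) (φ := fun _ : Fin m => ℝ) k).analyticOnNhd _)))
    ((hasFPowerSeriesOnBall_tail a j).analyticOnNhd.mono openPolydisc_subset_eball)

/-- The tail has no linear term. Strictness is what yields the two-point lower bound near 0 and,
later, local surjectivity onto the stable coordinates. -/
lemma hasStrictFDerivAt_parameterization (x : Fin n → ℝ) (ξ : Fin m → Fin n → ℝ)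
    (a : Fin n → EllOne m) :
    HasStrictFDerivAt (parameterization ℝ x ξ a)
      (∑ k, (ContinuousLinearMap.proj (R := ℝ) (φ := fun _ : Fin m => ℝ) k).smulRight (ξ k))
      0 := by
  refine hasStrictFDerivAt_pi'.2 fun j => ?_
  have h1 := (hasFPowerSeriesOnBall_tail a j).hasFPowerSeriesAt.hasStrictFDerivAt
  rw [tailMultilinear_one, map_zero] at h1
  have h2 : HasStrictFDerivAt (fun θ : Fin m → ℝ => ∑ k, ξ k j * θ k)
      (∑ k, ξ k j • ContinuousLinearMap.proj (R := ℝ) (φ := fun _ : Fin m => ℝ) k) 0 :=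
    HasStrictFDerivAt.fun_sum fun k _ =>
      (ContinuousLinearMap.proj (R := ℝ) (φ := fun _ : Fin m => ℝ) k).hasStrictFDerivAt.const_mul _
  refine ((h2.const_add (x j)).add h1).congr_fderiv ?_
  ext θ
  simp [mul_comm]

lemma parameterization_zero (x : Fin n → ℝ) (ξ : Fin m → Fin n → ℝ) (a : Fin n → EllOne m) :
    parameterization ℝ x ξ a 0 = x := by
  ext j
  have h0 : ∀ α, taylorTerm ℝ a j α 0 = 0 := fun α => by
    have hα : ∃ k, α.1 k ≠ 0 := by
      by_contra! h
      have : α.1 = 0 := Finsupp.ext h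
      have h2 := α.2
      simp [this] at h2
    obtain ⟨k, hk⟩ := hα
    rw [taylorTerm, Finset.prod_eq_zero (Finset.mem_univ k) (by simp [hk]), mul_zero]
  simp [parameterization, h0]

/-! ### Regularity of the vector field and uniqueness of solutions. -/

lemma hasStrictFDerivAt_eval (p : MvPolynomial (Fin n) ℝ) (x : Fin n → ℝ) :
    HasStrictFDerivAt (fun y : Fin n → ℝ => MvPolynomial.eval y p)
      (∑ i, MvPolynomial.eval x (MvPolynomial.pderiv i p) •
        ContinuousLinearMap.proj (R := ℝ) (φ := fun _ : Fin n => ℝ) i) x := by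
  induction p using MvPolynomial.induction_on with
  | C c => simpa using hasStrictFDerivAt_const c x
  | add p q hp hq =>
    simp only [map_add, add_smul, Finset.sum_add_distrib]
    exact hp.add hq
  | mul_X p i hp =>
    have h := hp.mul
      (ContinuousLinearMap.proj (R := ℝ) (φ := fun _ : Fin n => ℝ) i).hasStrictFDerivAt (x := x)
    simp only [map_mul, MvPolynomial.eval_X]
    refine h.congr_fderiv ?_
    simp only [MvPolynomial.pderiv_mul, MvPolynomial.pderiv_X, map_add, map_mul,
      MvPolynomial.eval_X, add_smul, Finset.sum_add_distrib, ContinuousLinearMap.proj_apply]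
    rw [add_comm]
    congr 1
    · simp only [Finset.smul_sum, smul_smul, mul_comm]
    · rw [Finset.sum_eq_single i]
      · simp
      · intro j _ hj
        simp [hj.symm]
      · simp

/-- Strictness gives both local Lipschitz bounds and the two-point linearization error at the zero.
-/
lemma hasStrictFDerivAt_vectorField (g : Fin n → MvPolynomial (Fin n) ℝ) (x : Fin n → ℝ) :
    HasStrictFDerivAt (vectorField g)
      (LinearMap.toContinuousLinearMap (Matrix.toLin' (jacobian g x))) x := by
  refine hasStrictFDerivAt_pi'.2 fun i => (hasStrictFDerivAt_eval (g i) x).congr_fderiv ?_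
  ext v
  simp [jacobian, Matrix.mulVec, dotProduct]

lemma exists_lipschitzOnWith_vectorField (g : Fin n → MvPolynomial (Fin n) ℝ)
    {s : Set (Fin n → ℝ)} (hs : IsCompact s) : ∃ K, LipschitzOnWith K (vectorField g) s := by
  have h : LocallyLipschitz (vectorField g) := fun x =>
    (hasStrictFDerivAt_vectorField g x).exists_lipschitzOnWith
  exact h.locallyLipschitzOn.exists_lipschitzOnWith_of_compact hs

lemma IsForwardSolution.continuousOn {g : Fin n → MvPolynomial (Fin n) ℝ} {y : Fin n → ℝ}
    {u : ℝ → Fin n → ℝ} (hu : IsForwardSolution g y u) : ContinuousOn u (Set.Ici 0) :=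
  fun t ht => (hu.2 t ht).continuousWithinAt

lemma IsForwardSolution.hasDerivAt {g : Fin n → MvPolynomial (Fin n) ℝ} {y : Fin n → ℝ}
    {u : ℝ → Fin n → ℝ} (hu : IsForwardSolution g y u) {t : ℝ} (ht : 0 < t) :
    HasDerivAt u (vectorField g (u t)) t :=
  (hu.2 t ht.le).hasDerivAt (Ici_mem_nhds ht)

lemma IsForwardSolution.hasDerivWithinAt_Ici {g : Fin n → MvPolynomial (Fin n) ℝ}
    {y : Fin n → ℝ} {u : ℝ → Fin n → ℝ} (hu : IsForwardSolution g y u) {t : ℝ} (ht : 0 ≤ t) :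
    HasDerivWithinAt u (vectorField g (u t)) (Set.Ici t) t :=
  (hu.2 t ht).mono (Set.Ici_subset_Ici.2 ht)

lemma IsForwardSolution.shift {g : Fin n → MvPolynomial (Fin n) ℝ}
    {y : Fin n → ℝ} {u : ℝ → Fin n → ℝ} (hu : IsForwardSolution g y u) {s : ℝ} (hs : 0 ≤ s) :
    IsForwardSolution g (u s) (fun t => u (t + s)) := by
  refine ⟨by simp, fun t ht => ?_⟩
  have h1 : HasDerivWithinAt (fun t => t + s) 1 (Set.Ici 0) t :=
    (hasDerivWithinAt_id t _).add_const s
  have h2 := (hu.2 (t + s) (add_nonneg ht hs)).scomp t h1 fun r hr => add_nonneg hr hs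
  simpa [Function.comp_def] using h2

/-- Solutions on a compact time interval which agree at its end agree at its beginning. -/
lemma IsForwardSolution.eq_of_eq {g : Fin n → MvPolynomial (Fin n) ℝ} {y z : Fin n → ℝ}
    {u v : ℝ → Fin n → ℝ} (hu : IsForwardSolution g y u) (hv : IsForwardSolution g z v)
    {T : ℝ} (hT : 0 ≤ T) (h : u T = v T) : y = z := by
  have hcu : ContinuousOn u (Set.Icc 0 T) := hu.continuousOn.mono Set.Icc_subset_Ici_self
  have hcv : ContinuousOn v (Set.Icc 0 T) := hv.continuousOn.mono Set.Icc_subset_Ici_self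
  -- A polynomial field is only locally Lipschitz; the two compact orbit segments supply a common
  -- constant.
  obtain ⟨K, hK⟩ := exists_lipschitzOnWith_vectorField g
    ((isCompact_Icc.image_of_continuousOn hcu).union (isCompact_Icc.image_of_continuousOn hcv))
  have key := ODE_solution_unique_of_mem_Icc_left (v := fun _ => vectorField g)
    (s := fun _ => u '' Set.Icc 0 T ∪ v '' Set.Icc 0 T) (K := K) (fun _ _ => hK)
    hcu (fun t ht => (hu.hasDerivAt ht.1).hasDerivWithinAt)
    (fun t ht => Or.inl ⟨t, Set.Ioc_subset_Icc_self ht, rfl⟩)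
    hcv (fun t ht => (hv.hasDerivAt ht.1).hasDerivWithinAt)
    (fun t ht => Or.inr ⟨t, Set.Ioc_subset_Icc_self ht, rfl⟩) h (Set.left_mem_Icc.2 hT)
  rwa [hu.1, hv.1] at key

/-! ### Contraction by the linear flow and the lower bound for the parameterization. -/

lemma isCompact_polydisc : IsCompact (polydisc ℝ m) := by
  have : polydisc ℝ m = Set.univ.pi fun _ => Metric.closedBall (0 : ℝ) 1 := by
    ext; simp [polydisc]
  rw [this]
  exact isCompact_univ_pi fun _ => isCompact_closedBall _ _

lemma isOpen_openPolydisc : IsOpen (openPolydisc ℝ m) := by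
  have : openPolydisc ℝ m = ⋂ k, {θ | ‖θ k‖ < 1} := by ext; simp [openPolydisc]
  rw [this]
  exact isOpen_iInter_of_finite fun k => isOpen_lt (by fun_prop) continuous_const

lemma openPolydisc_subset : openPolydisc ℝ m ⊆ polydisc ℝ m := fun _ h k => (h k).le

lemma zero_mem_openPolydisc : (0 : Fin m → ℝ) ∈ openPolydisc ℝ m := fun k => by simp

lemma norm_linearFlow_le {lam : Fin m → ℝ} {t C : ℝ} (hC : 0 ≤ C)
    (h : ∀ k, Real.exp (lam k * t) ≤ C) (θ : Fin m → ℝ) : ‖linearFlow lam t θ‖ ≤ C * ‖θ‖ := by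
  refine (pi_norm_le_iff_of_nonneg (by positivity)).2 fun k => ?_
  rw [linearFlow, norm_mul, Real.norm_of_nonneg (Real.exp_pos _).le]
  exact mul_le_mul (h k) (norm_le_pi_norm θ k) (norm_nonneg _) hC

lemma linearFlow_sub (lam : Fin m → ℝ) (t : ℝ) (θ θ' : Fin m → ℝ) :
    linearFlow lam t (θ - θ') = linearFlow lam t θ - linearFlow lam t θ' := by
  ext; simp [linearFlow, mul_sub]

lemma eventually_exp_le {lam : Fin m → ℝ} (hl : ∀ k, lam k < 0) {δ : ℝ} (hδ : 0 < δ) :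
    ∀ᶠ t in atTop, ∀ k, Real.exp (lam k * t) ≤ δ := by
  refine eventually_all.2 fun k => ?_
  have h : Tendsto (fun t => Real.exp (lam k * t)) atTop (𝓝 0) :=
    Real.tendsto_exp_atBot.comp (tendsto_id.const_mul_atTop_of_neg (hl k))
  exact (h.eventually (gt_mem_nhds hδ)).mono fun t ht => ht.le

lemma norm_le_one_of_mem {θ : Fin m → ℝ} (hθ : θ ∈ polydisc ℝ m) : ‖θ‖ ≤ 1 :=
  (pi_norm_le_iff_of_nonneg zero_le_one).2 hθ

lemma tendsto_linearFlow {lam : Fin m → ℝ} (hl : ∀ k, lam k < 0) (θ : Fin m → ℝ) :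
    Tendsto (fun t => linearFlow lam t θ) atTop (𝓝 0) := by
  refine tendsto_pi_nhds.2 fun k => ?_
  have h : Tendsto (fun t => Real.exp (lam k * t)) atTop (𝓝 0) :=
    Real.tendsto_exp_atBot.comp (tendsto_id.const_mul_atTop_of_neg (hl k))
  simpa [linearFlow] using h.mul_const (θ k)

/-- A map with injective strict derivative is bounded below near the point. -/
lemma exists_norm_sub_le_of_hasStrictFDerivAt {E F : Type*} [NormedAddCommGroup E]
    [NormedSpace ℝ E] [FiniteDimensional ℝ E] [NormedAddCommGroup F] [NormedSpace ℝ F]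
    {f : E → F} {L : E →L[ℝ] F} {x : E} (hf : HasStrictFDerivAt f L x)
    (hL : Function.Injective L) :
    ∃ C > 0, ∃ δ > 0, ∀ y ∈ Metric.ball x δ, ∀ z ∈ Metric.ball x δ,
      ‖y - z‖ ≤ C * ‖f y - f z‖ := by
  obtain ⟨K, hK, hLK⟩ := (L : E →ₗ[ℝ] F).exists_antilipschitzWith (LinearMap.ker_eq_bot.2 hL)
  have hK' : (0 : ℝ) < K := hK
  -- With this constant the linearization error costs half of ‖y - z‖, which is absorbed on the
  -- left.
  have h := hf.isLittleO.def (c := 1 / (2 * K)) (by positivity)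
  rw [nhds_prod_eq] at h
  obtain ⟨δ, hδ, h⟩ := Metric.nhds_basis_ball.prod_self.eventually_iff.1 h
  refine ⟨2 * K, by positivity, δ, hδ, fun y hy z hz => ?_⟩
  have h1 := h (x := (y, z)) ⟨hy, hz⟩
  have h2 := hLK.le_mul_dist y z
  simp only [dist_eq_norm] at h2
  have h3 : ‖L (y - z)‖ ≤ ‖f y - f z‖ + 1 / (2 * K) * ‖y - z‖ := by
    calc ‖L (y - z)‖ = ‖(f y - f z) - (f y - f z - L (y - z))‖ := by congr 1; abel
      _ ≤ _ := (norm_sub_le _ _).trans (add_le_add_right h1 _)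
  have h4 : ‖y - z‖ ≤ K * (‖f y - f z‖ + 1 / (2 * K) * ‖y - z‖) := by
    refine h2.trans (mul_le_mul_of_nonneg_left ?_ hK'.le)
    simpa [map_sub] using h3
  have h5 : K * (‖f y - f z‖ + 1 / (2 * K) * ‖y - z‖) = K * ‖f y - f z‖ + ‖y - z‖ / 2 := by
    field_simp
  linarith

/-- A map bounded below near a point has injective derivative there. -/
lemma injective_of_norm_sub_le {E F : Type*} [NormedAddCommGroup E] [NormedSpace ℝ E]
    [NormedAddCommGroup F] [NormedSpace ℝ F] {f : E → F} {L : E →L[ℝ] F} {x : E}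
    (hf : HasFDerivAt f L x) {C : ℝ} (hC : 0 < C)
    (h : ∀ᶠ y in 𝓝 x, ‖y - x‖ ≤ C * ‖f y - f x‖) : Function.Injective L := by
  refine (injective_iff_map_eq_zero L).2 fun v hv => ?_
  by_contra hne
  have hpos : 0 < ‖v‖ := norm_pos_iff.2 hne
  -- Along a kernel direction v the increment of `f` is at most ‖t • v‖ / (2C), against the lower
  -- bound ‖t • v‖ / C.
  have hb := (hf.isLittleO.def (c := 1 / (2 * C)) (by positivity)).and h
  have ht : Tendsto (fun t : ℝ => x + t • v) (𝓝[≠] 0) (𝓝 x) := by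
    have : Continuous fun t : ℝ => x + t • v := by fun_prop
    simpa using (this.tendsto 0).mono_left nhdsWithin_le_nhds
  obtain ⟨t, ⟨h1, h2⟩, ht0⟩ := ((ht.eventually hb).and self_mem_nhdsWithin).exists
  have ht0 : t ≠ 0 := ht0
  simp only [add_sub_cancel_left, map_smul, hv, smul_zero, sub_zero] at h1 h2
  have h3 := h2.trans (mul_le_mul_of_nonneg_left h1 hC.le)
  have h4 : C * (1 / (2 * C) * ‖t • v‖) = ‖t • v‖ / 2 := by field_simp
  have h5 : 0 < ‖t • v‖ := norm_pos_iff.2 (smul_ne_zero ht0 hne)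
  linarith

section Parameterization

variable {g : Fin n → MvPolynomial (Fin n) ℝ} {xt : Fin n → ℝ}
  {lam : Fin m → ℝ} {ξ : Fin m → Fin n → ℝ} {a : Fin n → EllOne m}

/-- Grönwall's inequality on the compact image of the polydisc, which these orbits never leave;
hence one K for all θ, θ' and t. -/
lemma dist_parameterization_linearFlow_le (hA1 : vectorField g xt = 0) (hl : ∀ k, lam k < 0)
    (hξ : ∀ k, Matrix.toLin' (jacobian g xt) (ξ k) = lam k • ξ k)
    (ha : zeroMap g lam xt ξ a = 0) :
    ∃ K : ℝ, ∀ θ ∈ polydisc ℝ m, ∀ θ' ∈ polydisc ℝ m, ∀ t, 0 ≤ t →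
      dist (parameterization ℝ xt ξ a (linearFlow lam t θ))
        (parameterization ℝ xt ξ a (linearFlow lam t θ')) ≤
      dist (parameterization ℝ xt ξ a θ) (parameterization ℝ xt ξ a θ') * Real.exp (K * t) := by
  obtain ⟨K, hK⟩ := exists_lipschitzOnWith_vectorField g
    (isCompact_polydisc.image_of_continuousOn (continuousOn_parameterization xt ξ a))
  refine ⟨K, fun θ hθ θ' hθ' t ht => ?_⟩
  have hu := isForwardSolution_parameterization hA1 hl hξ ha hθ
  have hv := isForwardSolution_parameterization hA1 hl hξ ha hθ'
  have key := dist_le_of_trajectories_ODE_of_mem (v := fun _ => vectorField g)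
    (s := fun _ => parameterization ℝ xt ξ a '' polydisc ℝ m) (K := K) (a := 0) (b := t)
    (δ := dist (parameterization ℝ xt ξ a θ) (parameterization ℝ xt ξ a θ'))
    (fun _ _ => hK) (hu.continuousOn.mono Set.Icc_subset_Ici_self)
    (fun s hs => hu.hasDerivWithinAt_Ici hs.1) (fun s hs => ⟨_, linearFlow_mem hl hs.1 hθ, rfl⟩)
    (hv.continuousOn.mono Set.Icc_subset_Ici_self)
    (fun s hs => hv.hasDerivWithinAt_Ici hs.1) (fun s hs => ⟨_, linearFlow_mem hl hs.1 hθ', rfl⟩)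
    (le_of_eq (by simp only [linearFlow_zero])) t (Set.right_mem_Icc.2 ht)
  simpa using key

lemma injective_linear_part (hξ : LinearIndependent ℝ ξ) :
    Function.Injective (∑ k, (ContinuousLinearMap.proj (R := ℝ)
      (φ := fun _ : Fin m => ℝ) k).smulRight (ξ k) : (Fin m → ℝ) →L[ℝ] Fin n → ℝ) := by
  refine (injective_iff_map_eq_zero _).2 fun v hv => ?_
  ext k
  refine Fintype.linearIndependent_iff.1 hξ v ?_ k
  simpa using hv

/-- The parameterization is bounded below on the whole closed polydisc. -/
lemma exists_norm_sub_le_parameterization (hA1 : vectorField g xt = 0) (hl : ∀ k, lam k < 0)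
    (hξ : ∀ k, Matrix.toLin' (jacobian g xt) (ξ k) = lam k • ξ k) (hξ' : LinearIndependent ℝ ξ)
    (ha : zeroMap g lam xt ξ a = 0) :
    ∃ C > 0, ∀ θ ∈ polydisc ℝ m, ∀ θ' ∈ polydisc ℝ m,
      ‖θ - θ'‖ ≤ C * ‖parameterization ℝ xt ξ a θ - parameterization ℝ xt ξ a θ'‖ := by
  obtain ⟨C, hC, δ, hδ, h⟩ := exists_norm_sub_le_of_hasStrictFDerivAt
    (hasStrictFDerivAt_parameterization xt ξ a) (injective_linear_part hξ')
  obtain ⟨K, hK⟩ := dist_parameterization_linearFlow_le hA1 hl hξ ha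
  obtain ⟨T, hT, hT0⟩ := ((eventually_exp_le hl (half_pos hδ)).and (eventually_ge_atTop 0)).exists
  have hball : ∀ θ ∈ polydisc ℝ m, linearFlow lam T θ ∈ Metric.ball 0 δ := fun θ hθ => by
    rw [mem_ball_zero_iff]
    have h1 := norm_linearFlow_le (half_pos hδ).le hT θ
    have h2 := mul_le_mul_of_nonneg_left (norm_le_one_of_mem hθ) (half_pos hδ).le
    linarith
  -- D bounds the norm of the inverse flow e^{-ΛT}.
  set D := ∑ k, Real.exp (lam k * -T) with hD
  have hD0 : 0 ≤ D := Finset.sum_nonneg fun _ _ => (Real.exp_pos _).le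
  have hDk : ∀ k, Real.exp (lam k * -T) ≤ D := fun k =>
    Finset.single_le_sum (f := fun k => Real.exp (lam k * -T))
      (fun _ _ => (Real.exp_pos _).le) (Finset.mem_univ k)
  -- D + 1 instead of D keeps the constant positive when m = 0.
  refine ⟨(D + 1) * (C * Real.exp (K * T)), by positivity, fun θ hθ θ' hθ' => ?_⟩
  have h1 : ‖θ - θ'‖ ≤ D * ‖linearFlow lam T θ - linearFlow lam T θ'‖ := by
    have := norm_linearFlow_le hD0 hDk (linearFlow lam T (θ - θ'))
    rwa [linearFlow_add, neg_add_cancel, linearFlow_zero, linearFlow_sub] at this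
  have h2 := h _ (hball θ hθ) _ (hball θ' hθ')
  have h3 := hK θ hθ θ' hθ' T hT0
  rw [dist_eq_norm, dist_eq_norm] at h3
  calc ‖θ - θ'‖ ≤ D * ‖linearFlow lam T θ - linearFlow lam T θ'‖ := h1
    _ ≤ (D + 1) * ‖linearFlow lam T θ - linearFlow lam T θ'‖ := by gcongr; linarith
    _ ≤ (D + 1) * (C * (‖parameterization ℝ xt ξ a θ - parameterization ℝ xt ξ a θ'‖ *
        Real.exp (K * T))) := by gcongr; exact h2.trans (by gcongr)
    _ = _ := by ring

end Parameterization

/-! ### Eigencoordinates and the cone condition at the hyperbolic zero. -/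

/-- Linear coordinates in which a matrix with real, simple, nonzero spectrum is diagonal. -/
lemma exists_eigencoordinates {J : Matrix (Fin n) (Fin n) ℝ}
    (hJ : HasRealDistinctNonzeroEigenvalues J) :
    ∃ (μ : Fin n → ℝ) (T : (Fin n → ℝ) ≃L[ℝ] (Fin n → ℝ)), Function.Injective μ ∧
      (∀ i, μ i ≠ 0) ∧ (∀ i, Module.End.HasEigenvalue (Matrix.toLin' J) (μ i)) ∧
      ∀ x i, T (Matrix.toLin' J x) i = μ i * T x i := by
  obtain ⟨hs, hnd, hne⟩ := hJ
  have hcard : J.charpoly.roots.toFinset.card = n := by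
    rw [Multiset.toFinset_card_of_nodup hnd, ← hs.natDegree_eq_card_roots,
      Matrix.charpoly_natDegree_eq_dim, Fintype.card_fin]
  set e := J.charpoly.roots.toFinset.equivFinOfCardEq hcard
  set μ : Fin n → ℝ := fun i => (e.symm i).1 with hμ
  have hinj : Function.Injective μ := Subtype.val_injective.comp e.symm.injective
  have hroot : ∀ i, μ i ∈ J.charpoly.roots := fun i => Multiset.mem_toFinset.1 (e.symm i).2
  have heig : ∀ i, Module.End.HasEigenvalue (Matrix.toLin' J) (μ i) := fun i => by
    rw [Module.End.hasEigenvalue_iff_isRoot_charpoly, Matrix.charpoly_toLin']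
    exact (Polynomial.mem_roots'.1 (hroot i)).2
  choose v hv using fun i => (heig i).exists_hasEigenvector
  have hli := Module.End.eigenvectors_linearIndependent' _ μ hinj v hv
  set b := basisOfLinearIndependentOfCardEqFinrank' v hli (by simp) with hb
  refine ⟨μ, b.equivFun.toContinuousLinearEquiv, hinj, fun i => hne _ (hroot i), heig,
    fun x i => ?_⟩
  have hbv : ∀ i, b i = v i := fun i => by simp [hb]
  change b.equivFun (Matrix.toLin' J x) i = μ i * b.equivFun x i
  have hx : Matrix.toLin' J x = ∑ i, (μ i * b.equivFun x i) • b i := by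
    conv_lhs => rw [← b.sum_equivFun x]
    rw [map_sum]
    refine Finset.sum_congr rfl fun i _ => ?_
    rw [map_smul, hbv, (hv i).apply_eq_smul, smul_smul, mul_comm]
  rw [hx, Module.Basis.equivFun_apply, b.repr_sum_self]

/-- The indefinite quadratic form `∑ sign(μ_i) w_i²`. -/
noncomputable def signForm (μ w : Fin n → ℝ) : ℝ := ∑ i, SignType.sign (μ i) * w i ^ 2

/-- Since sign(μ_i) μ_i = |μ_i|, the linear part contributes at least 2ν ∑ w_i². Each of the n error
terms is at most 2ν/(n+1) ∑ w_i², so together they cannot outweigh it. -/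
lemma signForm_deriv_nonneg {μ w ρ : Fin n → ℝ} {ν : ℝ} (hν : 0 < ν) (hμ : ∀ i, ν ≤ |μ i|)
    (hρ : ∀ i, |ρ i - μ i * w i| ≤ ν / (n + 1) * ‖w‖) :
    0 ≤ ∑ i, (SignType.sign (μ i) : ℝ) * (2 * w i * ρ i) := by
  set S := ∑ i, w i ^ 2 with hS
  have hS0 : 0 ≤ S := Finset.sum_nonneg fun _ _ => sq_nonneg _
  have hwi : ∀ i, |w i| ≤ √S := fun i => Real.abs_le_sqrt
    (Finset.single_le_sum (f := fun i => w i ^ 2) (fun _ _ => sq_nonneg _) (Finset.mem_univ i))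
  have hw : ‖w‖ ≤ √S := (pi_norm_le_iff_of_nonneg (Real.sqrt_nonneg S)).2 hwi
  have hterm : ∀ i, 2 * ν * w i ^ 2 - 2 * (ν / (n + 1)) * S ≤
      (SignType.sign (μ i) : ℝ) * (2 * w i * ρ i) := by
    intro i
    have h1 : (SignType.sign (μ i) : ℝ) * (2 * w i * ρ i) =
        2 * |μ i| * w i ^ 2 + 2 * (SignType.sign (μ i) * (w i * (ρ i - μ i * w i))) := by
      rw [← sign_mul_self (μ i)]; ring
    have h2 : |(SignType.sign (μ i) : ℝ) * (w i * (ρ i - μ i * w i))| ≤ ν / (n + 1) * S := by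
      have hs : |(SignType.sign (μ i) : ℝ)| ≤ 1 := by
        rcases SignType.trichotomy (SignType.sign (μ i)) with h | h | h <;> simp [h]
      calc _ ≤ 1 * (|w i| * |ρ i - μ i * w i|) := by rw [abs_mul, abs_mul]; gcongr
        _ ≤ √S * (ν / (n + 1) * √S) := by
          rw [one_mul]
          exact mul_le_mul (hwi i) ((hρ i).trans (by gcongr)) (abs_nonneg _) (Real.sqrt_nonneg _)
        _ = ν / (n + 1) * (√S * √S) := by ring
        _ = _ := by rw [Real.mul_self_sqrt hS0]
    have h3 := mul_le_mul_of_nonneg_right (hμ i) (sq_nonneg (w i))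
    have h4 := (abs_le.1 h2).1
    rw [h1]
    linarith
  refine le_trans ?_ (Finset.sum_le_sum fun i _ => hterm i)
  rw [Finset.sum_sub_distrib, ← Finset.mul_sum, ← hS, Finset.sum_const, Finset.card_univ,
    Fintype.card_fin, nsmul_eq_mul]
  have : (n : ℝ) * (2 * (ν / (n + 1)) * S) = 2 * ν * S * (n / (n + 1)) := by ring
  rw [this]
  have h5 : (n : ℝ) / (n + 1) ≤ 1 := (div_le_one (by positivity)).2 (by linarith)
  have h6 : 0 ≤ 2 * ν * S := by positivity
  nlinarith

lemma exists_pos_le_abs {μ : Fin n → ℝ} (h : ∀ i, μ i ≠ 0) : ∃ ν > 0, ∀ i, ν ≤ |μ i| := by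
  rcases isEmpty_or_nonempty (Fin n) with he | he
  · exact ⟨1, one_pos, fun i => he.elim i⟩
  · obtain ⟨i, hi⟩ := Finite.exists_min fun i => |μ i|
    exact ⟨|μ i|, abs_pos.2 (h i), hi⟩

/-- Two orbits staying near a hyperbolic zero and converging to it differ by a vector in the
closed negative cone of the quadratic form `signForm`. -/
lemma exists_signForm_sub_nonpos {g : Fin n → MvPolynomial (Fin n) ℝ} {xt : Fin n → ℝ}
    {μ : Fin n → ℝ} {T : (Fin n → ℝ) ≃L[ℝ] (Fin n → ℝ)} (hμ : ∀ i, μ i ≠ 0)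
    (hT : ∀ x i, T (Matrix.toLin' (jacobian g xt) x) i = μ i * T x i) :
    ∃ r > 0, ∀ (y z : Fin n → ℝ) (u v : ℝ → Fin n → ℝ), IsForwardSolution g y u →
      IsForwardSolution g z v → (∀ t, 0 ≤ t → u t ∈ Metric.ball xt r) →
      (∀ t, 0 ≤ t → v t ∈ Metric.ball xt r) → Tendsto u atTop (𝓝 xt) →
      Tendsto v atTop (𝓝 xt) → signForm μ (T (y - z)) ≤ 0 := by
  obtain ⟨ν, hν, hνμ⟩ := exists_pos_le_abs hμ
  set M := ‖(T : (Fin n → ℝ) →L[ℝ] (Fin n → ℝ))‖ with hM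
  set M' := ‖(T.symm : (Fin n → ℝ) →L[ℝ] (Fin n → ℝ))‖ with hM'
  have hMM : 0 < (M + 1) * (M' + 1) := by positivity
  -- Passing to eigencoordinates and back costs at most (M + 1)(M' + 1), which leaves the error
  -- ν/(n+1) allowed by `signForm_deriv_nonneg`. The added ones keep the divisor positive when n =
  -- 0.
  set ε := ν / (n + 1) / ((M + 1) * (M' + 1)) with hε
  have hε0 : 0 < ε := by positivity
  have h := (hasStrictFDerivAt_vectorField g xt).isLittleO.def hε0
  rw [nhds_prod_eq] at h
  obtain ⟨r, hr, h⟩ := Metric.nhds_basis_ball.prod_self.eventually_iff.1 h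
  have hest : ∀ p ∈ Metric.ball xt r, ∀ q ∈ Metric.ball xt r, ∀ i,
      |T (vectorField g p - vectorField g q) i - μ i * T (p - q) i| ≤
        ν / (n + 1) * ‖T (p - q)‖ := by
    intro p hp q hq i
    have h1 := h (x := (p, q)) ⟨hp, hq⟩
    have h2 : T (vectorField g p - vectorField g q) i - μ i * T (p - q) i =
        T (vectorField g p - vectorField g q - Matrix.toLin' (jacobian g xt) (p - q)) i := by
      rw [map_sub T (vectorField g p - vectorField g q), Pi.sub_apply, hT]
    have h3 : ‖p - q‖ ≤ M' * ‖T (p - q)‖ := by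
      simpa using (T.symm : (Fin n → ℝ) →L[ℝ] (Fin n → ℝ)).le_opNorm (T (p - q))
    rw [h2, ← Real.norm_eq_abs]
    calc _ ≤ ‖T (vectorField g p - vectorField g q -
          Matrix.toLin' (jacobian g xt) (p - q))‖ := norm_le_pi_norm _ i
      _ ≤ M * ‖vectorField g p - vectorField g q - Matrix.toLin' (jacobian g xt) (p - q)‖ :=
          (T : (Fin n → ℝ) →L[ℝ] (Fin n → ℝ)).le_opNorm _
      _ ≤ (M + 1) * (ε * ((M' + 1) * ‖T (p - q)‖)) := by
          refine mul_le_mul (by linarith) (h1.trans ?_) (norm_nonneg _) (by positivity)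
          refine mul_le_mul_of_nonneg_left (h3.trans ?_) hε0.le
          gcongr
          linarith
      _ = ε * ((M + 1) * (M' + 1)) * ‖T (p - q)‖ := by ring
      _ = ν / (n + 1) * ‖T (p - q)‖ := by rw [hε, div_mul_cancel₀ _ hMM.ne']
  refine ⟨r, hr, fun y z u v hu hv hur hvr hut hvt => ?_⟩
  have hV : Continuous fun d => signForm μ (T d) := by
    unfold signForm; fun_prop
  set V := fun t => signForm μ (T (u t - v t)) with hVdef
  have hder : ∀ t, 0 < t → HasDerivAt V (∑ i, (SignType.sign (μ i) : ℝ) *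
      (2 * T (u t - v t) i * T (vectorField g (u t) - vectorField g (v t)) i)) t := by
    intro t ht
    have h1 : HasDerivAt (fun t => T (u t - v t))
        (T (vectorField g (u t) - vectorField g (v t))) t :=
      (T : (Fin n → ℝ) →L[ℝ] (Fin n → ℝ)).hasFDerivAt.comp_hasDerivAt t
        ((hu.hasDerivAt ht).sub (hv.hasDerivAt ht))
    refine HasDerivAt.fun_sum fun i _ => ?_
    simpa using ((hasDerivAt_pi.1 h1 i).pow 2).const_mul (SignType.sign (μ i) : ℝ)
  have hmono : MonotoneOn V (Set.Ici 0) := by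
    refine monotoneOn_of_deriv_nonneg (convex_Ici 0)
      (hV.comp_continuousOn (hu.continuousOn.sub hv.continuousOn)) ?_ ?_
    · rw [interior_Ici]
      exact fun t ht => (hder t ht).differentiableAt.differentiableWithinAt
    · rw [interior_Ici]
      intro t ht
      rw [(hder t ht).deriv]
      exact signForm_deriv_nonneg hν hνμ
        (hest _ (hur t (le_of_lt ht)) _ (hvr t (le_of_lt ht)))
  have hlim : Tendsto V atTop (𝓝 0) := by
    have := (hV.tendsto (xt - xt)).comp (hut.sub hvt)
    simpa [hVdef, signForm, Function.comp_def] using this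
  have h0 : V 0 = signForm μ (T (y - z)) := by rw [hVdef]; simp only [hu.1, hv.1]
  rw [← h0]
  refine ge_of_tendsto hlim ?_
  filter_upwards [eventually_ge_atTop 0] with t ht
  exact hmono Set.self_mem_Ici ht ht

/-! ### The image of the polydisc as a local stable manifold. -/

lemma norm_linearFlow_le_self {lam : Fin m → ℝ} (hl : ∀ k, lam k < 0) {t : ℝ} (ht : 0 ≤ t)
    (θ : Fin m → ℝ) : ‖linearFlow lam t θ‖ ≤ ‖θ‖ := by
  simpa using norm_linearFlow_le zero_le_one (fun k => Real.exp_le_one_iff.2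
    (mul_nonpos_of_nonpos_of_nonneg (hl k).le ht)) θ

section Parameterization

variable {g : Fin n → MvPolynomial (Fin n) ℝ} {xt : Fin n → ℝ}
  {lam : Fin m → ℝ} {ξ : Fin m → Fin n → ℝ} {a : Fin n → EllOne m}

lemma tendsto_parameterization_linearFlow (hl : ∀ k, lam k < 0) (θ : Fin m → ℝ) :
    Tendsto (fun t => parameterization ℝ xt ξ a (linearFlow lam t θ)) atTop (𝓝 xt) := by
  have h := (hasStrictFDerivAt_parameterization xt ξ a).continuousAt
  rw [ContinuousAt, parameterization_zero] at h
  exact h.comp (tendsto_linearFlow hl θ)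

/-- Every orbit which stays near the zero and converges to it starts in the image of the open
polydisc. -/
lemma exists_nhds_mem_image (hA1 : vectorField g xt = 0)
    (hA2 : HasRealDistinctNonzeroEigenvalues (jacobian g xt))
    (hlam : EnumeratesStableEigenvalues (jacobian g xt) lam)
    (hξ : ∀ k, Module.End.HasEigenvector (Matrix.toLin' (jacobian g xt)) (lam k) (ξ k))
    (ha : zeroMap g lam xt ξ a = 0) :
    ∃ W ∈ 𝓝 xt, ∀ y u, IsForwardSolution g y u → (∀ t, 0 ≤ t → u t ∈ W) →
      Tendsto u atTop (𝓝 xt) → y ∈ parameterization ℝ xt ξ a '' openPolydisc ℝ m := by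
  have hl : ∀ k, lam k < 0 := fun k => ((hlam.2 _).1 ⟨k, rfl⟩).1
  have hξ1 : ∀ k, Matrix.toLin' (jacobian g xt) (ξ k) = lam k • ξ k :=
    fun k => (hξ k).apply_eq_smul
  obtain ⟨μ, T, hinj, hne, heig, hT⟩ := exists_eigencoordinates hA2
  obtain ⟨r, hr, hcone⟩ := exists_signForm_sub_nonpos hne hT
  have hTξ : ∀ k i, μ i ≠ lam k → T (ξ k) i = 0 := by
    intro k i hi
    have h1 := hT (ξ k) i
    rw [hξ1, map_smul, Pi.smul_apply, smul_eq_mul] at h1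
    have h2 : (μ i - lam k) * T (ξ k) i = 0 := by linarith
    exact (mul_eq_zero.1 h2).resolve_left (sub_ne_zero.2 hi)
  have hex : ∀ k, ∃ i, μ i = lam k := by
    intro k
    by_contra! h
    refine (hξ k).2 (T.injective ?_)
    rw [map_zero]
    exact funext fun i => hTξ k i (h i)
  choose ι hι using hex
  have hc : ∀ k, T (ξ k) (ι k) ≠ 0 := by
    intro k h
    refine (hξ k).2 (T.injective ?_)
    rw [map_zero]
    funext i
    by_cases hi : μ i = lam k
    · rw [hinj (hi.trans (hι k).symm), h]; rfl
    · exact hTξ k i hi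
  -- π reads off the stable eigencoordinates. The derivative of π ∘ P at 0 is diagonal with nonzero
  -- entries T(ξ_k)_{ι k}, so π ∘ P maps neighborhoods of 0 onto neighborhoods of π(x̃).
  set π : (Fin n → ℝ) →L[ℝ] (Fin m → ℝ) := ContinuousLinearMap.pi fun k =>
    (ContinuousLinearMap.proj (R := ℝ) (φ := fun _ : Fin n => ℝ) (ι k)).comp
      (T : (Fin n → ℝ) →L[ℝ] (Fin n → ℝ)) with hπ
  have hπx : ∀ x k, π x k = T x (ι k) := fun x k => rfl
  have hQ := π.hasStrictFDerivAt.comp 0 (hasStrictFDerivAt_parameterization xt ξ a)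
  have hsurj := hQ.map_nhds_eq_of_surj (by
    refine LinearMap.range_eq_top.2 fun w => ⟨fun k => w k / T (ξ k) (ι k), ?_⟩
    funext k
    simp only [ContinuousLinearMap.coe_coe, ContinuousLinearMap.comp_apply, hπx]
    simp only [sum_apply, ContinuousLinearMap.smulRight_apply, ContinuousLinearMap.proj_apply,
      map_sum, map_smul, Finset.sum_apply, Pi.smul_apply, smul_eq_mul]
    rw [Finset.sum_eq_single k]
    · field_simp [hc k]
    · intro l _ hlk
      rw [hTξ l (ι k) (by rw [hι]; exact fun h => hlk (hlam.1 h).symm), mul_zero]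
    · simp)
  have hcont := (hasStrictFDerivAt_parameterization xt ξ a).continuousAt
  rw [ContinuousAt, parameterization_zero] at hcont
  -- The linear flow does not increase norms, so an orbit starting in P(ball 0 δ) stays in the ball
  -- where the cone condition holds.
  obtain ⟨δ, hδ, hball⟩ := Metric.mem_nhds_iff.1 (inter_mem (hcont (Metric.ball_mem_nhds xt hr))
    (isOpen_openPolydisc.mem_nhds zero_mem_openPolydisc))
  have hN := image_mem_map (m := fun θ => π (parameterization ℝ xt ξ a θ)) (Metric.ball_mem_nhds 0 hδ)
  rw [hsurj, parameterization_zero] at hN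
  refine ⟨Metric.ball xt r ∩ π ⁻¹' ((fun θ => π (parameterization ℝ xt ξ a θ)) '' Metric.ball 0 δ),
    inter_mem (Metric.ball_mem_nhds xt hr) (π.continuous.continuousAt hN),
    fun y u hu hW hlim => ?_⟩
  obtain ⟨θ, hθ, hθy⟩ : y ∈ π ⁻¹' ((fun θ => π (parameterization ℝ xt ξ a θ)) '' Metric.ball 0 δ) := by
    have := (hW 0 le_rfl).2
    rwa [hu.1] at this
  have hθo : θ ∈ openPolydisc ℝ m := (hball hθ).2
  have hv := isForwardSolution_parameterization hA1 hl hξ1 ha (openPolydisc_subset hθo)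
  have hle := hcone y _ u _ hu hv (fun t ht => (hW t ht).1) (fun t ht => (hball (by
    rw [mem_ball_zero_iff] at hθ ⊢
    exact (norm_linearFlow_le_self hl ht θ).trans_lt hθ)).1) hlim
    (tendsto_parameterization_linearFlow hl θ)
  set w := T (y - parameterization ℝ xt ξ a θ) with hw
  have hstable : ∀ k, w (ι k) = 0 := by
    intro k
    have h1 := congrFun hθy k
    simp only [hπx] at h1
    rw [hw, map_sub, Pi.sub_apply, h1, sub_self]
  -- The negative squares vanish because y and P(θ) share their stable coordinates.
  have hsq : ∀ i, (SignType.sign (μ i) : ℝ) * w i ^ 2 = w i ^ 2 := by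
    intro i
    rcases lt_or_gt_of_ne (hne i) with hi | hi
    · obtain ⟨k, hk⟩ := (hlam.2 (μ i)).2 ⟨hi, heig i⟩
      rw [← hinj ((hι k).trans hk), hstable]
      simp
    · simp [sign_pos hi]
  have hsum : ∑ i, w i ^ 2 = 0 := by
    refine le_antisymm ?_ (Finset.sum_nonneg fun _ _ => sq_nonneg _)
    simpa only [signForm, hsq] using hle
  have hw0 : w = 0 := funext fun i =>
    pow_eq_zero_iff (two_ne_zero) |>.1
      ((Finset.sum_eq_zero_iff_of_nonneg fun _ _ => sq_nonneg _).1 hsum i (Finset.mem_univ i))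
  refine ⟨θ, hθo, (sub_eq_zero.1 (T.injective ?_)).symm⟩
  rw [← hw, hw0, map_zero]

/-- The image of the closed polydisc is a local stable manifold. -/
lemma exists_image_eq_localStableManifold (hA1 : vectorField g xt = 0)
    (hA2 : HasRealDistinctNonzeroEigenvalues (jacobian g xt))
    (hlam : EnumeratesStableEigenvalues (jacobian g xt) lam)
    (hξ : ∀ k, Module.End.HasEigenvector (Matrix.toLin' (jacobian g xt)) (lam k) (ξ k))
    (ha : zeroMap g lam xt ξ a = 0)
    (hP : Set.InjOn (parameterization ℝ xt ξ a) (polydisc ℝ m)) :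
    ∃ U ∈ 𝓝 xt, parameterization ℝ xt ξ a '' polydisc ℝ m = localStableManifold g xt U := by
  have hl : ∀ k, lam k < 0 := fun k => ((hlam.2 _).1 ⟨k, rfl⟩).1
  have hξ1 : ∀ k, Matrix.toLin' (jacobian g xt) (ξ k) = lam k • ξ k :=
    fun k => (hξ k).apply_eq_smul
  obtain ⟨W, hW, hWimg⟩ := exists_nhds_mem_image hA1 hA2 hlam hξ ha
  set P := parameterization ℝ xt ξ a with hPdef
  have hcont : ContinuousOn P (polydisc ℝ m) := continuousOn_parameterization xt ξ a
  have hsol : ∀ θ ∈ polydisc ℝ m,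
      IsForwardSolution g (P θ) fun t => P (linearFlow lam t θ) :=
    fun θ hθ => isForwardSolution_parameterization hA1 hl hξ1 ha hθ
  have himg : IsCompact (P '' polydisc ℝ m) := isCompact_polydisc.image_of_continuousOn hcont
  have hbd : IsClosed (P '' (polydisc ℝ m \ openPolydisc ℝ m)) :=
    ((isCompact_polydisc.diff isOpen_openPolydisc).image_of_continuousOn
      (hcont.mono Set.sdiff_subset)).isClosed
  have hxt : xt ∉ P '' (polydisc ℝ m \ openPolydisc ℝ m) := by
    rintro ⟨θ, ⟨hθ, hθ'⟩, h⟩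
    rw [← parameterization_zero xt ξ a] at h
    exact hθ' (hP hθ (openPolydisc_subset zero_mem_openPolydisc) h ▸ zero_mem_openPolydisc)
  obtain ⟨r, hr, hrbd⟩ := Metric.nhds_basis_closedBall.mem_iff.1 (hbd.isOpen_compl.mem_nhds hxt)
  -- The ball misses the image of the boundary of the polydisc, so an orbit in U can enter the image
  -- from outside only through P of the open polydisc.
  refine ⟨P '' polydisc ℝ m ∪ Metric.closedBall xt r,
    mem_of_superset (Metric.closedBall_mem_nhds xt hr) Set.subset_union_right,
    Set.Subset.antisymm ?_ ?_⟩
  · rintro _ ⟨θ, hθ, rfl⟩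
    exact ⟨_, hsol θ hθ, fun t ht => Or.inl ⟨_, linearFlow_mem hl ht hθ, rfl⟩,
      tendsto_parameterization_linearFlow hl θ⟩
  · rintro y ⟨u, hu, huU, hlim⟩
    obtain ⟨T, hT⟩ := eventually_atTop.1 (hlim.eventually hW)
    have hT0 : u (max T 0) ∈ P '' polydisc ℝ m :=
      Set.image_mono openPolydisc_subset (hWimg _ _ (hu.shift (le_max_right T 0))
        (fun t ht => hT _ (by linarith [le_max_left T 0]))
        (hlim.comp (tendsto_atTop_add_const_right _ _ tendsto_id)))
    -- The orbit ends up in the image; S is compact, so there is a first time t₀ at which it lies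
    -- there.
    set S := Set.Icc 0 (max T 0) ∩ u ⁻¹' (P '' polydisc ℝ m) with hS
    have hucont : ContinuousOn u (Set.Icc 0 (max T 0)) :=
      hu.continuousOn.mono Set.Icc_subset_Ici_self
    have hScl : IsCompact S := isCompact_Icc.of_isClosed_subset
      (hucont.preimage_isClosed_of_isClosed isClosed_Icc himg.isClosed) Set.inter_subset_left
    obtain ⟨t₀, ⟨ht₀, θ, hθ, hθu⟩, hmin⟩ :=
      hScl.exists_isLeast ⟨_, Set.right_mem_Icc.2 (le_max_right T 0), hT0⟩
    rcases ht₀.1.eq_or_lt with h0 | hpos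
    · rw [← h0, hu.1] at hθu
      exact ⟨θ, hθ, hθu⟩
    exfalso
    have hball : ∀ t ∈ Set.Ico 0 t₀, u t ∈ Metric.closedBall xt r := fun t ht =>
      (huU t ht.1).resolve_left fun h =>
        absurd (hmin ⟨⟨ht.1, ht.2.le.trans ht₀.2⟩, h⟩) (not_le.2 ht.2)
    have hut₀ : u t₀ ∈ Metric.closedBall xt r := by
      refine Metric.isClosed_closedBall.mem_of_tendsto
        (hu.hasDerivAt hpos).continuousAt.continuousWithinAt.tendsto (b := 𝓝[<] t₀) ?_
      filter_upwards [Ico_mem_nhdsLT hpos] with t ht using hball t ht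
    have hθo : θ ∈ openPolydisc ℝ m := by
      by_contra h
      exact hrbd (hθu ▸ hut₀) ⟨θ, ⟨hθ, h⟩, rfl⟩
    -- As θ is interior, the linear flow can be run backwards for a short time s. Uniqueness then
    -- puts u(t₀ - s) in the image, against minimality of t₀.
    have hback : Tendsto (fun s => linearFlow lam (-s) θ) (𝓝[>] 0) (𝓝 θ) := by
      have : Continuous fun s => linearFlow lam (-s) θ :=
        continuous_pi fun k => by unfold linearFlow; fun_prop
      simpa [linearFlow_zero] using (this.tendsto 0).mono_left nhdsWithin_le_nhds
    obtain ⟨s, hs, hs0, hst⟩ := ((hback.eventually (isOpen_openPolydisc.mem_nhds hθo)).and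
      (Ioc_mem_nhdsGT hpos)).exists
    have hs' := openPolydisc_subset hs
    have heq := (hu.shift (sub_nonneg.2 hst)).eq_of_eq (hsol _ hs') hs0.le (by
      simp only [linearFlow_add, add_neg_cancel, linearFlow_zero, hθu, add_sub_cancel])
    have := hmin ⟨⟨sub_nonneg.2 hst, by linarith [ht₀.2]⟩, ⟨_, hs', heq.symm⟩⟩
    linarith

end Parameterization

end StableParam

open StableParam in
theorem mainTheorem3 {n m : ℕ} (g : Fin n → MvPolynomial (Fin n) ℝ) (xt : Fin n → ℝ)
    (hA1 : StableParam.vectorField g xt = 0)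
    (hA2 : StableParam.HasRealDistinctNonzeroEigenvalues (StableParam.jacobian g xt))
    (lam : Fin m → ℝ)
    (hlam : StableParam.EnumeratesStableEigenvalues (StableParam.jacobian g xt) lam)
    (ξ : Fin m → Fin n → ℝ)
    (hξ : ∀ k, Module.End.HasEigenvector
      (Matrix.toLin' (StableParam.jacobian g xt)) (lam k) (ξ k))
    (hA3 : StableParam.NonResonant lam)
    (a : Fin n → StableParam.EllOne m)
    (ha : StableParam.zeroMap g lam xt ξ a = 0) :
    -- absolute and uniform convergence on the complex closed unit polydisc
    (∀ j, ∀ z ∈ StableParam.polydisc ℂ m,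
      Summable fun α => ‖StableParam.taylorTerm ℂ a j α z‖) ∧
    (∀ j, TendstoUniformlyOn
      (fun (s : Finset (StableParam.MultiIndex m)) z => ∑ α ∈ s, StableParam.taylorTerm ℂ a j α z)
      (fun z => ∑' α, StableParam.taylorTerm ℂ a j α z) atTop (StableParam.polydisc ℂ m)) ∧
    -- `P` is continuous and one-to-one on the real closed polydisc, and a real analytic
    -- immersion of the open one
    ContinuousOn (StableParam.parameterization ℝ xt ξ a) (StableParam.polydisc ℝ m) ∧
    Set.InjOn (StableParam.parameterization ℝ xt ξ a) (StableParam.polydisc ℝ m) ∧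
    AnalyticOnNhd ℝ (StableParam.parameterization ℝ xt ξ a) (StableParam.openPolydisc ℝ m) ∧
    (∀ θ ∈ StableParam.openPolydisc ℝ m,
      Function.Injective (fderiv ℝ (StableParam.parameterization ℝ xt ξ a) θ)) ∧
    -- `P(0) = x̃` and `DP(0) = [ξ_1 | ⋯ | ξ_m]`
    StableParam.parameterization ℝ xt ξ a 0 = xt ∧
    HasFDerivAt (StableParam.parameterization ℝ xt ξ a)
      (∑ k, (ContinuousLinearMap.proj (R := ℝ) (φ := fun _ : Fin m => ℝ) k).smulRight (ξ k)) 0 ∧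
    -- `P` conjugates the linear flow to the flow of `g`
    (∀ θ ∈ StableParam.polydisc ℝ m,
      StableParam.IsForwardSolution g (StableParam.parameterization ℝ xt ξ a θ)
        (fun t => StableParam.parameterization ℝ xt ξ a (StableParam.linearFlow lam t θ))) ∧
    -- the image is a local stable manifold of `x̃`
    ∃ U ∈ 𝓝 xt, StableParam.parameterization ℝ xt ξ a '' StableParam.polydisc ℝ m =
      StableParam.localStableManifold g xt U := by

  have hl : ∀ k, lam k < 0 := fun k => ((hlam.2 _).1 ⟨k, rfl⟩).1
  have hξ1 : ∀ k, Matrix.toLin' (jacobian g xt) (ξ k) = lam k • ξ k :=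
    fun k => (hξ k).apply_eq_smul
  have hξ2 : LinearIndependent ℝ ξ :=
    Module.End.eigenvectors_linearIndependent' _ lam hlam.1 ξ hξ
  obtain ⟨C, hC, hlow⟩ := exists_norm_sub_le_parameterization hA1 hl hξ1 hξ2 ha
  have hinj : Set.InjOn (parameterization ℝ xt ξ a) (polydisc ℝ m) := by
    intro θ hθ θ' hθ' h
    have h1 := hlow θ hθ θ' hθ'
    rw [h, sub_self, norm_zero, mul_zero] at h1
    exact sub_eq_zero.1 (norm_le_zero_iff.1 h1)
  refine ⟨fun j z hz => summable_norm_taylorTerm a j hz,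
    fun j => tendstoUniformlyOn_taylorTerm ℂ a j, continuousOn_parameterization xt ξ a, hinj,
    analyticOnNhd_parameterization xt ξ a, fun θ hθ => ?_, parameterization_zero xt ξ a,
    (hasStrictFDerivAt_parameterization xt ξ a).hasFDerivAt,
    fun θ hθ => isForwardSolution_parameterization hA1 hl hξ1 ha hθ,
    exists_image_eq_localStableManifold hA1 hA2 hlam hξ ha hinj⟩
  -- The global lower bound, read at a fixed interior θ, excludes a kernel of the derivative.
  refine injective_of_norm_sub_le
    (analyticOnNhd_parameterization xt ξ a θ hθ).differentiableAt.hasFDerivAt hC ?_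
  filter_upwards [isOpen_openPolydisc.mem_nhds hθ] with y hy
  exact hlow y (openPolydisc_subset hy) θ (openPolydisc_subset hθ)
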